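/- **Setting.** Let $\mathbb S$ be a collection of rings and/or abelian groups, $\mathbf W$ a finite set of weight symbols (each $\mathtt w$ with an arity $\ge 1$ and a type in $\mathbb S$), $\mathbb P$ a collection of predicate names $\mathsf P$, each with a type in $\mathbb S^{m}$ ($m\ge 1$) and a semantics $[\![\mathsf P]\!]$ contained in the product of its type, and $\sigma^*$ a finite relational signature. A $(\sigma^*,\mathbf W)$-structure $\mathcal A$ is a finite non-empty relational $\sigma^*$-structure with universe $A$ and a function $\mathtt w^{\mathcal A}\colon A^{\mathrm{ar}(\mathtt w)}\to\mathrm{type}(\mathtt w)$ for every $\mathtt w\in\mathbf W$, such that $\mathtt w^{\mathcal A}(a_1,\dots,a_m)\ne 0$ implies $m=1$, or $a_1=\dots=a_m$, or that $a_1,\dots,a_m$ all occur in a common tuple of some relation of $\mathcal A$. Two distinct elements are adjacent in the Gaifman graph if they occur in a common tuple of some relation; the degree of $\mathcal A$, distances and balls refer to this graph. The $r$-neighbourhood of a non-empty tuple is the induced substructure on its $r$-ball. Formulas are those of first-order logic with weight aggregation $\mathrm{FOWA}(\mathbb P)[\sigma^*,\mathbb S,\mathbf W]$: they are built from $x=y$,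 $R(\bar x)$, $s=\mathtt w(\bar x)$ by $\neg$, $\vee$, $\exists$, the construct $s=\sum\mathtt w(\bar y).\varphi$, and $\mathsf P(t_1,\dots,t_m)$ for terms $t_i$ of the right types, where terms are built from constants $s$ and $\mathtt w(\bar x)$ by $+$, $-$, in rings $\cdot$, and the aggregation $\sum p.\varphi$ of a product $p$ of weights and constants (in a group: a single factor) over all values of the variables of $p$ that satisfy $\varphi$. A formula with at least one free variable is $r$-local if on every structure its truth value at every assignment is the one in the $r$-neighbourhood of the elements assigned to its free variables (nothing is required of sentences). A Feferman–Vaught decomposition in $\Phi^*$ of $\varphi$ with respect to a partition $(\bar z;\bar z')$ of its free variables is a finite non-empty set $\Delta$ of pairs $(\alpha(\bar z),\beta(\bar z'))$ of formulas in $\Phi^*$ such that, for all structures $\mathcal A,\mathcal B$ and all tuples $\bar a,\bar b$ from them, the disjoint union of $\mathcal A$ and $\mathcal B$ satisfies $\varphi[\bar a,\bar b]$ iff $\mathcal A\models\alpha[\bar a]$ and $\mathcal B\models\beta[\bar b]$ for some $(\alpha,\beta)\in\Delta$. An algorithm with local access to $\mathcal A$ handles elements of $A$ as atoms; it may compare elements,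 ask whether $\bar a\in R^{\mathcal A}$, ask for $\mathtt w^{\mathcal A}(\bar a)$, and ask for a list of all neighbours of an element in the Gaifman graph, and it obtains elements only from its input and from neighbourhood queries. It is a while-program on binary trees over such atoms, in which elementary steps, equality tests for weights, ring and group operations, and tests of the predicates in $\mathbb P$ have unit cost and reading or writing an element of $A$ costs $\lfloor\log_2|A|\rfloor+1$. **Theorem.** Let $k,\ell,r\in\mathbb N$ with $k\ge 1$ or $\ell=0$, and let $\Phi^*$ be a finite non-empty set of $r$-local formulas $\varphi(\bar x,\bar y)$, $|\bar x|=k$, $|\bar y|=\ell$, such that (i) every $\varphi\in\Phi^*$ has a Feferman–Vaught decomposition in $\Phi^*$ with respect to every partition of its free variables into two (possibly empty) parts, and (ii) for all $\varphi_1,\varphi_2\in\Phi^*$ the set $\Phi^*$ contains formulas equivalent to $\neg\varphi_1$ and to $\varphi_1\vee\varphi_2$. For a structure $\mathcal A^*$ with universe $A$, let $\mathcal H:=\mathcal C(\Phi^*,\mathcal A^*,k,\ell)$ be the class of all maps $h_{\varphi,\bar v}\colon A^k\to\{0,1\}$ with $h_{\varphi,\bar v}(\bar a)=1\iff\mathcal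 A^*\models\varphi[\bar a,\bar v]$, for $\varphi\in\Phi^*$, $\bar v\in A^\ell$. There are $s,C\in\mathbb N$ such that for every family $M=(M_\varphi)_{\varphi\in\Phi^*}$ of programs there is a program $L$ with the following property. Let $\mathcal A^*$ be a $(\sigma^*,\mathbf W)$-structure with $n$ elements and degree $d$, and let $f_{\Phi^*}(\mathcal A^*)$ be an upper bound on the time of model checking on $\mathcal A^*$ by $M$, that is, with local access to $\mathcal A^*$ each $M_\varphi$ decides in time at most $f_{\Phi^*}(\mathcal A^*)$, for all given $\bar a\in A^k$, $\bar v\in A^\ell$, whether $\mathcal A^*\models\varphi[\bar a,\bar v]$. Put $t_{\mathcal H}(\varepsilon,\delta):=s\cdot\lceil\log(n/\delta)/\varepsilon^2\rceil$. Then for all $\varepsilon,\delta\in(0,1)$, on every training sequence $T\in(A^k\times\{0,1\})^{t_{\mathcal H}(\varepsilon,\delta)}$, the program $L$ with only local access to $\mathcal A^*$ returns a pair $L(T)=(\varphi^*,\bar v^*)$ with $\varphi^*\in\Phi^*$ and $\bar v^*\in A^\ell$ within at most $$C\cdot f_{\Phi^*}(\mathcal A^*)\cdot\Bigl(\log n+d+\tfrac1\varepsilon+\log\tfrac1\delta\Bigr)^{C}$$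 steps; the hypothesis $h_{\varphi^*,\bar v^*}$ has minimal training error on $T$ among all $h\in\mathcal H$, and every entry of $\bar v^*$ has distance at most $(2r+1)\ell$ from some element occurring in $T$. Moreover $L$ is an agnostic PAC learner for $\mathcal H$ with sample size $t_{\mathcal H}$: for all $\varepsilon,\delta\in(0,1)$ and every probability distribution $\mathcal D$ on $A^k\times\{0,1\}$, if $T$ consists of $t_{\mathcal H}(\varepsilon,\delta)$ examples drawn i.i.d. from $\mathcal D$, then $$\Pr_T\Bigl(\mathrm{err}_{\mathcal D}(h_{L(T)})\le\inf_{h\in\mathcal H}\mathrm{err}_{\mathcal D}(h)+\varepsilon\Bigr)\ge 1-\delta,\qquad \mathrm{err}_{\mathcal D}(h):=\Pr_{(\bar a,b)\sim\mathcal D}(h(\bar a)\ne b).$$ -/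

import Mathlib

open MeasureTheory

noncomputable section

namespace WeightAgg

/-! ## Collections of rings and abelian groups, signatures, predicates -/

/-- A collection of rings (first family) and of abelian groups that are not regarded as
rings (second family). -/
structure WeightDomains where
  RingIdx : Type
  GroupIdx : Type
  R : RingIdx → Type
  G : GroupIdx → Type
  ring : ∀ i, Ring (R i)
  group : ∀ i, AddCommGroup (G i)

attribute [instance] WeightDomains.ring WeightDomains.group

/-- The index set of all members of the collection. -/
abbrev WeightDomains.Idx (S : WeightDomains) : Type := S.RingIdx ⊕ S.GroupIdx

/-- The underlying set of a member of the collection. -/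
def WeightDomains.Carrier (S : WeightDomains) : S.Idx → Type
  | .inl i => S.R i
  | .inr i => S.G i

instance (S : WeightDomains) : ∀ i, AddCommGroup (S.Carrier i)
  | .inl i => inferInstanceAs (AddCommGroup (S.R i))
  | .inr i => inferInstanceAs (AddCommGroup (S.G i))

instance (S : WeightDomains) (i : S.RingIdx) : Ring (S.Carrier (.inl i)) :=
  inferInstanceAs (Ring (S.R i))

/-- A finite relational signature; arity `0` is allowed. -/
structure Signature where
  Rel : Type
  ar : Rel → ℕ
  finite : Finite Rel

/-- A finite set of weight symbols, each with a positive arity and a type. -/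
structure WeightSymbols (S : WeightDomains) where
  Sym : Type
  ar : Sym → ℕ
  type : Sym → S.Idx
  ar_pos : ∀ w, 0 < ar w
  finite : Finite Sym

/-- A predicate collection: names with arity, type and semantics. -/
structure PredicateCollection (S : WeightDomains) where
  Name : Type
  ar : Name → ℕ
  type : ∀ p, Fin (ar p) → S.Idx
  sem : ∀ p, Set (∀ i, S.Carrier (type p i))
  ar_pos : ∀ p, 0 < ar p
  countable : Countable Name

variable {S : WeightDomains} (σ : Signature) (W : WeightSymbols S) (P : PredicateCollection S)

/-! ## Weighted structures -/

/-- A finite non-empty relational structure with weight functions, without the locality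
condition on the weights. (An induced substructure of a weighted structure need not satisfy
the locality condition.) -/
structure PreStruct where
  Carrier : Type
  fintype : Fintype Carrier
  nonempty : Nonempty Carrier
  rel : ∀ R : σ.Rel, Set (Fin (σ.ar R) → Carrier)
  wt : ∀ w : W.Sym, (Fin (W.ar w) → Carrier) → S.Carrier (W.type w)

attribute [instance] PreStruct.fintype PreStruct.nonempty

/-- A `(σ, W)`-structure: nonzero weights of arity at least two sit on constant tuples or on
tuples whose entries occur together in a tuple of some relation. -/
structure WStruct extends PreStruct σ W where
  wt_local : ∀ (w : W.Sym) (a : Fin (W.ar w) → Carrier), wt w a ≠ 0 →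
    W.ar w = 1 ∨ (∀ i j, a i = a j) ∨
      ∃ (R : σ.Rel) (b : Fin (σ.ar R) → Carrier), b ∈ rel R ∧ Set.range a ⊆ Set.range b

variable {σ W}

/-- The Gaifman graph. -/
def PreStruct.gaifman (A : PreStruct σ W) : SimpleGraph A.Carrier where
  Adj a b := a ≠ b ∧ ∃ (R : σ.Rel) (t : Fin (σ.ar R) → A.Carrier),
    t ∈ A.rel R ∧ a ∈ Set.range t ∧ b ∈ Set.range t
  symm := ⟨fun _ _ h => ⟨h.1.symm, h.2.imp fun _ h => h.imp fun _ h => ⟨h.1, h.2.2, h.2.1⟩⟩⟩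
  loopless := ⟨fun _ h => h.1 rfl⟩

/-- The size of a structure. -/
def PreStruct.size (A : PreStruct σ W) : ℕ := Fintype.card A.Carrier

/-- The degree of a structure: the maximum number of neighbours in the Gaifman graph. -/
def PreStruct.degree (A : PreStruct σ W) : ℕ :=
  Finset.univ.sup fun a : A.Carrier => (A.gaifman.neighborSet a).ncard

/-- The `r`-ball of a set of elements. -/
def PreStruct.ball (A : PreStruct σ W) (r : ℕ) (B : Set A.Carrier) : Set A.Carrier :=
  {b | ∃ a ∈ B, A.gaifman.edist a b ≤ (r : ℕ∞)}

theorem PreStruct.subset_ball (A : PreStruct σ W) (r : ℕ) (B : Set A.Carrier) :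
    B ⊆ A.ball r B :=
  fun a ha => ⟨a, ha, by simp⟩

/-- The induced substructure on a non-empty set. -/
def PreStruct.induce (A : PreStruct σ W) (B : Set A.Carrier) (hB : B.Nonempty) :
    PreStruct σ W where
  Carrier := B
  fintype := Fintype.ofFinite B
  nonempty := hB.to_subtype
  rel R := {t | (fun i => (t i : A.Carrier)) ∈ A.rel R}
  wt w t := A.wt w fun i => t i

/-- The `r`-neighbourhood of a non-empty set of elements. -/
def PreStruct.nbhd (A : PreStruct σ W) (r : ℕ) (B : Set A.Carrier) (hB : B.Nonempty) :
    PreStruct σ W :=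
  A.induce (A.ball r B) (hB.mono (A.subset_ball r B))

open Classical in
/-- The disjoint union of two structures (the disjoint sum without its two additional unary
relations, which do not occur in the formulas considered here). -/
def PreStruct.disjUnion (A B : PreStruct σ W) : PreStruct σ W where
  Carrier := A.Carrier ⊕ B.Carrier
  fintype := inferInstance
  nonempty := inferInstance
  rel R := {t | (∃ a ∈ A.rel R, t = Sum.inl ∘ a) ∨ (∃ b ∈ B.rel R, t = Sum.inr ∘ b)}
  wt w t :=
    if h : ∃ a : Fin (W.ar w) → A.Carrier, t = Sum.inl ∘ a then A.wt w h.choose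
    else if h : ∃ b : Fin (W.ar w) → B.Carrier, t = Sum.inr ∘ b then B.wt w h.choose
    else 0

/-! ## The weight aggregation logic: syntax -/

variable (W)

/-- A factor of a product of weights: a constant or `w(y₁, …, y_k)` with pairwise distinct
variables. Variables are natural numbers. -/
inductive WFactor : S.Idx → Type
  | const (i : S.Idx) (s : S.Carrier i) : WFactor i
  | wt (w : W.Sym) (ys : Fin (W.ar w) ↪ ℕ) : WFactor (W.type w)

/-- `W`-products: a single factor in a group, a non-empty product of factors in a ring. -/
inductive WProduct : S.Idx → Type
  | group (i : S.GroupIdx) (t : WFactor W (.inr i)) : WProduct (.inr i)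
  | ring (i : S.RingIdx) (t : WFactor W (.inl i)) (ts : List (WFactor W (.inl i))) :
      WProduct (.inl i)

variable {W}

/-- The variables of a factor. -/
def WFactor.vars {i : S.Idx} : WFactor W i → Finset ℕ
  | .const _ _ => ∅
  | .wt _ ys => Finset.univ.map ys

/-- The variables of a `W`-product. -/
def WProduct.vars {i : S.Idx} : WProduct W i → Finset ℕ
  | .group _ t => t.vars
  | .ring _ t ts => (t :: ts).foldr (fun u V => u.vars ∪ V) ∅

/-- The value of a factor. -/
def WFactor.val (A : PreStruct σ W) (β : ℕ → A.Carrier) {i : S.Idx} :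
    WFactor W i → S.Carrier i
  | .const _ s => s
  | .wt w ys => A.wt w fun j => β (ys j)

/-- The value of a `W`-product. -/
def WProduct.val (A : PreStruct σ W) (β : ℕ → A.Carrier) {i : S.Idx} :
    WProduct W i → S.Carrier i
  | .group _ t => t.val A β
  | .ring _ t ts => ((t :: ts).map fun u => u.val A β).prod

variable (σ W)

mutual
/-- Formulas of the weight aggregation logic. -/
inductive Formula : Type
  | eq (x y : ℕ) : Formula
  | rel (R : σ.Rel) (xs : Fin (σ.ar R) → ℕ) : Formula
  /-- `s = w(x₁, …, x_k)` -/
  | wtEq (w : W.Sym) (s : S.Carrier (W.type w)) (xs : Fin (W.ar w) ↪ ℕ) : Formula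
  | not (φ : Formula) : Formula
  | or (φ ψ : Formula) : Formula
  | ex (y : ℕ) (φ : Formula) : Formula
  /-- `s = ∑ w(y₁, …, y_k).φ` -/
  | sumEq (w : W.Sym) (s : S.Carrier (W.type w)) (ys : Fin (W.ar w) ↪ ℕ) (φ : Formula) : Formula
  | pred (p : P.Name) (ts : ∀ j : Fin (P.ar p), Term (P.type p j)) : Formula
/-- Terms of the weight aggregation logic. -/
inductive Term : S.Idx → Type
  | const (i : S.Idx) (s : S.Carrier i) : Term i
  | wt (w : W.Sym) (xs : Fin (W.ar w) ↪ ℕ) : Term (W.type w)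
  | add (i : S.Idx) (t u : Term i) : Term i
  | sub (i : S.Idx) (t u : Term i) : Term i
  | mul (i : S.RingIdx) (t u : Term (.inl i)) : Term (.inl i)
  /-- `∑ p.φ` -/
  | sum (i : S.Idx) (p : WProduct W i) (φ : Formula) : Term i
end

variable {σ W P}

mutual
/-- The free variables of a formula. -/
def Formula.free : Formula σ W P → Finset ℕ
  | .eq x y => {x, y}
  | .rel _ xs => Finset.univ.image xs
  | .wtEq _ _ xs => Finset.univ.map xs
  | .not φ => φ.free
  | .or φ ψ => φ.free ∪ ψ.free
  | .ex y φ => φ.free \ {y}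
  | .sumEq _ _ ys φ => φ.free \ Finset.univ.map ys
  | .pred _ ts => Finset.univ.biUnion fun j => (ts j).free
/-- The free variables of a term. -/
def Term.free {i : S.Idx} : Term σ W P i → Finset ℕ
  | .const _ _ => ∅
  | .wt _ xs => Finset.univ.map xs
  | .add _ t u => t.free ∪ u.free
  | .sub _ t u => t.free ∪ u.free
  | .mul _ t u => t.free ∪ u.free
  | .sum _ p φ => φ.free \ p.vars
end

/-! ## The weight aggregation logic: semantics -/

/-- The assignment that follows `a` on `V` and `β` elsewhere. -/
def override {α : Type} (β : ℕ → α) (V : Finset ℕ) (a : V → α) : ℕ → α :=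
  fun z => if h : z ∈ V then a ⟨z, h⟩ else β z

open Classical in
mutual
/-- `φ.Sat A β`: the interpretation `(A, β)` satisfies `φ`. -/
def Formula.Sat (A : PreStruct σ W) : Formula σ W P → (ℕ → A.Carrier) → Prop
  | .eq x y, β => β x = β y
  | .rel R xs, β => (fun i => β (xs i)) ∈ A.rel R
  | .wtEq w s xs, β => s = A.wt w fun i => β (xs i)
  | .not φ, β => ¬ φ.Sat A β
  | .or φ ψ, β => φ.Sat A β ∨ ψ.Sat A β
  | .ex y φ, β => ∃ a : A.Carrier, φ.Sat A (Function.update β y a)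
  | .sumEq w s ys φ, β =>
      s = ∑ a : {z // z ∈ Finset.univ.map ys} → A.Carrier,
        if φ.Sat A (override β _ a) then A.wt w fun i => override β _ a (ys i) else 0
  | .pred p ts, β => (fun j => (ts j).val A β) ∈ P.sem p
/-- The value of a term in the interpretation `(A, β)`. -/
def Term.val (A : PreStruct σ W) {i : S.Idx} :
    Term σ W P i → (ℕ → A.Carrier) → S.Carrier i
  | .const _ s, _ => s
  | .wt w xs, β => A.wt w fun j => β (xs j)
  | .add _ t u, β => t.val A β + u.val A β
  | .sub _ t u, β => t.val A β - u.val A β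
  | .mul _ t u, β => t.val A β * u.val A β
  | .sum _ p φ, β =>
      ∑ a : p.vars → A.Carrier,
        if φ.Sat A (override β _ a) then p.val A (override β _ a) else 0
end

/-- Logical equivalence on all weighted structures. -/
def Formula.Equiv (φ ψ : Formula σ W P) : Prop :=
  ∀ (A : WStruct σ W) (β : ℕ → A.Carrier), φ.Sat A.toPreStruct β ↔ ψ.Sat A.toPreStruct β

/-- `φ` is `r`-local around its free variables: its truth value in a weighted structure is its
truth value in the `r`-neighbourhood of the elements assigned to the free variables. Sentences
have no such neighbourhood, and nothing is required of them. -/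
def Formula.IsLocal (r : ℕ) (φ : Formula σ W P) : Prop :=
  ∀ (A : WStruct σ W) (β : ℕ → A.Carrier) (h : (β '' (φ.free : Set ℕ)).Nonempty)
    (β' : ℕ → (A.nbhd r (β '' (φ.free : Set ℕ)) h).Carrier),
    (∀ z ∈ φ.free, (β' z).1 = β z) →
      (φ.Sat A.toPreStruct β ↔ φ.Sat (A.nbhd r (β '' (φ.free : Set ℕ)) h) β')

/-- `Δ` is a Feferman–Vaught decomposition of `φ` in `Φ` with respect to `(Z; Z')`. -/
def IsFVDecomposition (Φ : Set (Formula σ W P)) (φ : Formula σ W P) (Z Z' : Finset ℕ)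
    (Δ : Set (Formula σ W P × Formula σ W P)) : Prop :=
  Δ.Finite ∧ Δ.Nonempty ∧
  (∀ p ∈ Δ, p.1 ∈ Φ ∧ p.2 ∈ Φ ∧ p.1.free ⊆ Z ∧ p.2.free ⊆ Z') ∧
  ∀ (A B : WStruct σ W) (β : ℕ → A.Carrier) (γ : ℕ → B.Carrier),
    φ.Sat (A.disjUnion B.toPreStruct)
        (fun z => if z ∈ Z then Sum.inl (β z) else Sum.inr (γ z)) ↔
      ∃ p ∈ Δ, p.1.Sat A.toPreStruct β ∧ p.2.Sat B.toPreStruct γ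

/-- Every formula of `Φ` has a Feferman–Vaught decomposition in `Φ` with respect to every
partition of its free variables into two parts. -/
def ClosedUnderFV (Φ : Set (Formula σ W P)) : Prop :=
  ∀ φ ∈ Φ, ∀ Z Z' : Finset ℕ, Disjoint Z Z' → Z ∪ Z' = φ.free →
    ∃ Δ, IsFVDecomposition Φ φ Z Z' Δ

/-- Up to equivalence, `Φ` is closed under negation and disjunction. -/
def ClosedUnderBool (Φ : Set (Formula σ W P)) : Prop :=
  (∀ φ ∈ Φ, ∃ ψ ∈ Φ, ψ.Equiv φ.not) ∧
  (∀ φ₁ ∈ Φ, ∀ φ₂ ∈ Φ, ∃ ψ ∈ Φ, ψ.Equiv (φ₁.or φ₂))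

/-! ## Algorithms with local access

Programs compute on binary trees whose leaves are `nil` or atoms. Elements of the structure are
atoms: a program can compare them, query relations and weights at them and ask for their
neighbours, but it can obtain new elements only as answers to neighbourhood queries. Elements of
the rings and groups are atoms too, with the operations, equality and the predicates of the
collection available at unit cost. -/

variable (σ W P)

/-- Constants that may occur in a program: weights and names of formulas. -/
inductive Const
  | weight (i : S.Idx) (s : S.Carrier i)
  | form (φ : Formula σ W P)

/-- Data over a universe `α`. -/
inductive Val (α : Type)
  | nil
  | elem (a : α)
  | const (c : Const σ W P)
  | pair (u v : Val α)

/-- Programs; each program computes a partial function from data to data. -/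
inductive Code
  | id
  | nil
  | const (c : Const σ W P)
  | pair (f g : Code)
  | head
  | tail
  | isPair
  | eq
  | comp (f g : Code)
  /-- if `c` then `f` else `g` -/
  | ite (c f g : Code)
  /-- while `c` do `f` -/
  | loop (c f : Code)
  | rel (R : σ.Rel)
  | wt (w : W.Sym)
  | nbrs
  | add (i : S.Idx)
  | sub (i : S.Idx)
  | mul (i : S.RingIdx)
  | pred (p : P.Name)

variable {σ W P}

/-- `nil` is false. -/
def Val.false {α : Type} : Val σ W P α := .nil

/-- `pair nil nil` is true. -/
def Val.true {α : Type} : Val σ W P α := .pair .nil .nil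

open Classical in
/-- The truth value of a proposition. -/
def Val.ofProp {α : Type} (p : Prop) : Val σ W P α := if p then .true else .false

/-- The encoding of a list. -/
def Val.ofList {α : Type} : List (Val σ W P α) → Val σ W P α
  | [] => .nil
  | v :: l => .pair v (ofList l)

/-- The encoding of a tuple of elements. -/
def Val.tuple {α : Type} {m : ℕ} (a : Fin m → α) : Val σ W P α :=
  .ofList (List.ofFn fun i => .elem (a i))

/-- The answers to neighbourhood queries: for every element, a list without repetitions of its
neighbours in the Gaifman graph, in an arbitrary order. -/
structure NbrOracle (A : PreStruct σ W) where
  list : A.Carrier → List A.Carrier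
  nodup : ∀ a, (list a).Nodup
  mem_iff : ∀ a b, b ∈ list a ↔ A.gaifman.Adj a b

/-- The number of bits of the name of an element: the cost of reading or writing it. -/
def PreStruct.word (A : PreStruct σ W) : ℕ := Nat.log 2 A.size + 1

/-- `Eval A nb c v u τ`: with local access to `A`, the program `c` on input `v` stops with
output `u` after `τ` steps. Elements `a` are read and written at cost `A.word`. -/
inductive Eval (A : PreStruct σ W) (nb : NbrOracle A) :
    Code σ W P → Val σ W P A.Carrier → Val σ W P A.Carrier → ℕ → Prop
  | id (v) : Eval A nb .id v v 1
  | nil (v) : Eval A nb .nil v .nil 1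
  | const (c v) : Eval A nb (.const c) v (.const c) 1
  | pair {f g v u w m n} : Eval A nb f v u m → Eval A nb g v w n →
      Eval A nb (.pair f g) v (.pair u w) (m + n + 1)
  | head (u v) : Eval A nb .head (.pair u v) u 1
  | tail (u v) : Eval A nb .tail (.pair u v) v 1
  | isPair (v) : Eval A nb .isPair v (.ofProp (∃ u w, v = .pair u w)) 1
  | eq_elem (a b) : Eval A nb .eq (.pair (.elem a) (.elem b)) (.ofProp (a = b)) (2 * A.word)
  | eq_const (c d) : Eval A nb .eq (.pair (.const c) (.const d)) (.ofProp (c = d)) 1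
  | comp {f g v u w m n} : Eval A nb g v u m → Eval A nb f u w n →
      Eval A nb (.comp f g) v w (m + n + 1)
  | ite_true {c f g v u w m n} : Eval A nb c v u m → u ≠ .nil → Eval A nb f v w n →
      Eval A nb (.ite c f g) v w (m + n + 1)
  | ite_false {c f g v w m n} : Eval A nb c v .nil m → Eval A nb g v w n →
      Eval A nb (.ite c f g) v w (m + n + 1)
  | loop_stop {c f v m} : Eval A nb c v .nil m → Eval A nb (.loop c f) v v (m + 1)
  | loop_step {c f v u v' w m n p} : Eval A nb c v u m → u ≠ .nil → Eval A nb f v v' n →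
      Eval A nb (.loop c f) v' w p → Eval A nb (.loop c f) v w (m + n + p + 1)
  | rel (R) (a : Fin (σ.ar R) → A.Carrier) :
      Eval A nb (.rel R) (.tuple a) (.ofProp (a ∈ A.rel R)) (A.word * σ.ar R + 1)
  | wt (w) (a : Fin (W.ar w) → A.Carrier) :
      Eval A nb (.wt w) (.tuple a) (.const (.weight (W.type w) (A.wt w a)))
        (A.word * W.ar w + 1)
  | nbrs (a) : Eval A nb .nbrs (.elem a) (.ofList ((nb.list a).map .elem))
      (A.word * ((nb.list a).length + 1) + 1)
  | add (i s t) : Eval A nb (.add i)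
      (.pair (.const (.weight i s)) (.const (.weight i t))) (.const (.weight i (s + t))) 1
  | sub (i s t) : Eval A nb (.sub i)
      (.pair (.const (.weight i s)) (.const (.weight i t))) (.const (.weight i (s - t))) 1
  | mul (i) (s t : S.Carrier (.inl i)) : Eval A nb (.mul i)
      (.pair (.const (.weight (.inl i) s)) (.const (.weight (.inl i) t)))
      (.const (.weight (.inl i) (s * t))) 1
  | pred (p) (s : ∀ j : Fin (P.ar p), S.Carrier (P.type p j)) : Eval A nb (.pred p)
      (.ofList (List.ofFn fun j => .const (.weight (P.type p j) (s j))))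
      (.ofProp (s ∈ P.sem p)) 1

/-! ## Learning -/

/-- Labelled examples. -/
abbrev Example (A : PreStruct σ W) (k : ℕ) : Type := (Fin k → A.Carrier) × Bool

instance (A : PreStruct σ W) : MeasurableSpace A.Carrier := ⊤

/-- The assignment with values `a` at the variables `x` and `v` at the variables `y` (and
arbitrary values elsewhere). -/
def assign {α : Type} [Nonempty α] {k ℓ : ℕ} (x : Fin k → ℕ) (y : Fin ℓ → ℕ)
    (a : Fin k → α) (v : Fin ℓ → α) : ℕ → α :=
  Function.extend (Sum.elim x y) (Sum.elim a v) fun _ => Classical.arbitrary α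

open Classical in
/-- The classifier given by a formula `φ` and parameters `v`. -/
def classifier (A : PreStruct σ W) {k ℓ : ℕ} (x : Fin k → ℕ) (y : Fin ℓ → ℕ)
    (φ : Formula σ W P) (v : Fin ℓ → A.Carrier) : (Fin k → A.Carrier) → Bool :=
  fun a => decide (φ.Sat A (assign x y a v))

/-- The concept class of `Φ` on `A`. -/
def conceptClass (Φ : Set (Formula σ W P)) (A : PreStruct σ W) {k ℓ : ℕ} (x : Fin k → ℕ)
    (y : Fin ℓ → ℕ) : Set ((Fin k → A.Carrier) → Bool) :=
  {h | ∃ φ ∈ Φ, ∃ v : Fin ℓ → A.Carrier, h = classifier A x y φ v}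

/-- The generalisation error. -/
def genError {A : PreStruct σ W} {k : ℕ} (D : Measure (Example A k))
    (h : (Fin k → A.Carrier) → Bool) : ℝ :=
  D.real {z | h z.1 ≠ z.2}

/-- The training error. -/
def trainError {A : PreStruct σ W} {k t : ℕ} (T : Fin t → Example A k)
    (h : (Fin k → A.Carrier) → Bool) : ℝ :=
  ({i | h (T i).1 ≠ (T i).2} : Set (Fin t)).ncard / t

/-- `learn` is an agnostic PAC learner for `H` with sample size `tH`. -/
def IsAgnosticPACLearner {A : PreStruct σ W} {k : ℕ} (H : Set ((Fin k → A.Carrier) → Bool))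
    (tH : ℝ → ℝ → ℕ)
    (learn : ∀ t : ℕ, (Fin t → Example A k) → (Fin k → A.Carrier) → Bool) : Prop :=
  ∀ ε ∈ Set.Ioo (0 : ℝ) 1, ∀ δ ∈ Set.Ioo (0 : ℝ) 1,
    ∀ D : Measure (Example A k), IsProbabilityMeasure D →
      1 - δ ≤ (Measure.pi fun _ : Fin (tH ε δ) => D).real
        {T | genError D (learn _ T) ≤ sInf (genError D '' H) + ε}

/-- The sample size `s * ⌈log (n / δ) / ε ^ 2⌉`. -/
def sampleSize (s n : ℕ) (ε δ : ℝ) : ℕ := s * ⌈Real.log (n / δ) / ε ^ 2⌉₊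

/-- The encoding of a training sequence as the input of a program. -/
def encodeTraining {A : PreStruct σ W} {k t : ℕ} (T : Fin t → Example A k) :
    Val σ W P A.Carrier :=
  .ofList (List.ofFn fun i => .pair (.tuple (T i).1) (.ofProp ((T i).2 = true)))

/-- The encoding of a hypothesis as the output of a program. -/
def encodeHypothesis {A : PreStruct σ W} {ℓ : ℕ} (h : Formula σ W P × (Fin ℓ → A.Carrier)) :
    Val σ W P A.Carrier :=
  .pair (.const (.form h.1)) (.tuple h.2)

/-- For every formula `φ` in `Φ`, the program `M φ` with local access to `A` decides in time at
most `τ`, given tuples `a` and `v`, whether `A` satisfies `φ` at `(a, v)`. -/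
def ModelChecksWithin (M : Formula σ W P → Code σ W P) (Φ : Set (Formula σ W P))
    (A : PreStruct σ W) (nb : NbrOracle A) {k ℓ : ℕ} (x : Fin k → ℕ) (y : Fin ℓ → ℕ)
    (τ : ℝ) : Prop :=
  ∀ φ ∈ Φ, ∀ (a : Fin k → A.Carrier) (v : Fin ℓ → A.Carrier),
    ∃ m : ℕ, Eval A nb (M φ) (.tuple (Fin.append a v))
      (.ofProp (φ.Sat A (assign x y a v))) m ∧ (m : ℝ) ≤ τ

end WeightAgg

end

open WeightAgg

-- The learner is empirical risk minimisation: it returns a hypothesis with the fewest errors on the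
-- training sequence. Write `n` for the size of the structure, `t` for the number of examples and
-- `q` for `ℓ + |Φ|`.
--
-- Sample size. The concept class has at most `n ^ q + 1` members (`ncard_conceptClass_le`). Fix a
-- best member `h₀`. For a member at least `ε` worse, Hoeffding's inequality for the difference of
-- the two error indicators shows that it makes no more training errors than `h₀` with probability
-- at most `exp (-(t * ε ^ 2 / 2))` (`measureReal_count_le_count`). A union bound over the members
-- other than `h₀` leaves `n ^ q` such terms, and the sample size with `s = 2 * q` pushes their sum
-- below `δ` (`exp_sampleSize_le`).
--
-- Search space. Trying all of `A ^ ℓ` would be too slow, but parameters close to the set `X` of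
-- elements occurring in the examples suffice (`exists_near_hypothesis`). Cut the surroundings of
-- `X` into `ℓ + 1` annuli of width `2 * r + 1`; the `ℓ` parameters miss one of them. Inside it lie
-- `X` and the near parameters, beyond it the far ones, so the two groups are more than `2 * r + 1`
-- apart. Their `r`-balls then share no point, no tuple of a relation and no nonzero weight, and by
-- locality the formula behaves as if the groups lay in two disjoint copies of the structure
-- (`Formula.IsLocal.sat_disjUnion_iff`). A Feferman–Vaught decomposition separates them. The far
-- halves have truth values that do not depend on the example, so the formula agrees on all examples
-- with the disjunction of those near halves whose far half is true. Boolean closure puts this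
-- disjunction into `Φ` up to equivalence, and the far parameters no longer matter.
--
-- Running time. With `R = (2 * r + 1) * ℓ`, neighbourhood queries list at most `k * t * (d + 1) ^
-- R` elements near the examples. Each formula with each `ℓ`-tuple of them is tested on all examples
-- by model checking (`Runs.learner`). The cost is linear in the model checking time and polynomial
-- in `t`, `d` and the word length (`learnerCost_polyBounded`); the latter quantities are polynomial
-- in `log n + d + 1 / ε + log (1 / δ)` (`parameters_le`).

noncomputable section

namespace WeightAgg

variable {S : WeightDomains} {σ : Signature} {W : WeightSymbols S} {P : PredicateCollection S}

/-! ## Invariance of satisfaction under isomorphisms -/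

/-- Isomorphisms of weighted structures. -/
structure PreStruct.Iso (A B : PreStruct σ W) where
  equiv : A.Carrier ≃ B.Carrier
  rel_iff : ∀ R (t : Fin (σ.ar R) → A.Carrier), (equiv ∘ t) ∈ B.rel R ↔ t ∈ A.rel R
  wt_eq : ∀ w (t : Fin (W.ar w) → A.Carrier), B.wt w (equiv ∘ t) = A.wt w t

/-- The identity isomorphism. -/
def PreStruct.Iso.refl (A : PreStruct σ W) : A.Iso A where
  equiv := Equiv.refl _
  rel_iff _ _ := Iff.rfl
  wt_eq _ _ := rfl

theorem PreStruct.Iso.mem_rel_iff {A B : PreStruct σ W} (e : A.Iso B) {R : σ.Rel}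
    {t : Fin (σ.ar R) → A.Carrier} {u : Fin (σ.ar R) → B.Carrier}
    (h : ∀ i, e.equiv (t i) = u i) : t ∈ A.rel R ↔ u ∈ B.rel R := by
  rw [← e.rel_iff, show e.equiv ∘ t = u from funext h]

theorem PreStruct.Iso.wt_congr {A B : PreStruct σ W} (e : A.Iso B) {w : W.Sym}
    {t : Fin (W.ar w) → A.Carrier} {u : Fin (W.ar w) → B.Carrier}
    (h : ∀ i, e.equiv (t i) = u i) : A.wt w t = B.wt w u := by
  rw [← e.wt_eq, show e.equiv ∘ t = u from funext h]

theorem WFactor.val_iso {A B : PreStruct σ W} (e : A.Iso B) {i : S.Idx} (t : WFactor W i)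
    {β : ℕ → A.Carrier} {γ : ℕ → B.Carrier} (h : ∀ z ∈ t.vars, e.equiv (β z) = γ z) :
    t.val A β = t.val B γ := by
  cases t with
  | const => rfl
  | wt w ys => exact e.wt_congr fun j => h _ (by simp [WFactor.vars])

theorem WProduct.val_iso {A B : PreStruct σ W} (e : A.Iso B) {i : S.Idx} (p : WProduct W i)
    {β : ℕ → A.Carrier} {γ : ℕ → B.Carrier} (h : ∀ z ∈ p.vars, e.equiv (β z) = γ z) :
    p.val A β = p.val B γ := by
  cases p with
  | group i t => exact t.val_iso e h
  | ring i t ts =>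
    have aux : ∀ l : List (WFactor W (.inl i)),
        (∀ z ∈ l.foldr (fun u V => u.vars ∪ V) ∅, e.equiv (β z) = γ z) →
        l.map (fun u => u.val A β) = l.map fun u => u.val B γ := by
      intro l
      induction l with
      | nil => intro _; rfl
      | cons u l ih =>
        intro hl
        simp only [List.foldr_cons, Finset.mem_union] at hl
        simp only [List.map_cons]
        rw [u.val_iso e fun z hz => hl z (Or.inl hz), ih fun z hz => hl z (Or.inr hz)]
    exact congrArg List.prod (aux (t :: ts) h)

theorem override_iso {α α' : Type} (e : α ≃ α') {β : ℕ → α} {γ : ℕ → α'} {V F : Finset ℕ}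
    (h : ∀ z ∈ F \ V, e (β z) = γ z) (a : V → α) :
    ∀ z ∈ F, e (override β V a z) = override γ V (e ∘ a) z := by
  intro z hz
  unfold override
  by_cases hV : z ∈ V
  · simp [hV]
  · simpa [hV] using h z (by simp [hz, hV])

theorem override_iso_of_mem {α α' : Type} (e : α ≃ α') (β : ℕ → α) (γ : ℕ → α') {V : Finset ℕ}
    (a : V → α) : ∀ z ∈ V, e (override β V a z) = override γ V (e ∘ a) z := by
  intro z hz
  simp [override, hz]

mutual
-- Induction over formulas and terms simultaneously. Quantifiers are transported along the
-- bijection, and aggregation sums are reindexed along the induced bijection of assignments. Asking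
-- for agreement on free variables only makes the coincidence lemma the special case of the
-- identity.
theorem Formula.sat_iso {A B : PreStruct σ W} (e : A.Iso B) : ∀ (φ : Formula σ W P)
    {β : ℕ → A.Carrier} {γ : ℕ → B.Carrier}, (∀ z ∈ φ.free, e.equiv (β z) = γ z) →
      (φ.Sat A β ↔ φ.Sat B γ)
  | .eq x y, β, γ, h => by
      simp only [Formula.Sat]
      rw [← h x (by simp [Formula.free]), ← h y (by simp [Formula.free]),
        e.equiv.injective.eq_iff]
  | .rel R xs, β, γ, h => by
      simp only [Formula.Sat]
      exact e.mem_rel_iff fun i => h _ (by simp [Formula.free])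
  | .wtEq w s xs, β, γ, h => by
      simp only [Formula.Sat]
      rw [e.wt_congr fun i => h (xs i) (by simp [Formula.free])]
  | .not φ, β, γ, h => by
      simp only [Formula.Sat]
      rw [Formula.sat_iso e φ fun z hz => h z (by simpa [Formula.free] using hz)]
  | .or φ ψ, β, γ, h => by
      simp only [Formula.Sat]
      rw [Formula.sat_iso e φ fun z hz => h z (by simp [Formula.free, hz]),
        Formula.sat_iso e ψ fun z hz => h z (by simp [Formula.free, hz])]
  | .ex y φ, β, γ, h => by
      simp only [Formula.Sat]
      rw [← e.equiv.exists_congr_right]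
      refine exists_congr fun a => Formula.sat_iso e φ fun z hz => ?_
      by_cases hzy : z = y
      · simp [hzy]
      · simpa [hzy] using h z (by simp [Formula.free, hz, hzy])
  | .sumEq w s ys φ, β, γ, h => by
      simp only [Formula.Sat]
      have : ∀ a : {z // z ∈ Finset.univ.map ys} → A.Carrier,
          (φ.Sat A (override β _ a) ↔ φ.Sat B (override γ _ (e.equiv ∘ a))) := fun a =>
        Formula.sat_iso e φ (override_iso e.equiv (by simpa only [Formula.free] using h) a)
      refine Eq.congr_right ?_
      refine Fintype.sum_equiv (Equiv.arrowCongr (Equiv.refl _) e.equiv) _ _ fun a => ?_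
      have h2 : Equiv.arrowCongr (Equiv.refl _) e.equiv a = e.equiv ∘ a := rfl
      rw [h2, e.wt_congr fun i => override_iso_of_mem e.equiv β γ a (ys i) (by simp)]
      classical exact if_congr (this a) rfl rfl
  | .pred p ts, β, γ, h => by
      simp only [Formula.Sat]
      have : (fun j => (ts j).val A β) = fun j => (ts j).val B γ := funext fun j =>
        Term.val_iso e (ts j) fun z hz => h z (by
          simp only [Formula.free, Finset.mem_biUnion, Finset.mem_univ, true_and]
          exact ⟨j, hz⟩)
      rw [this]
theorem Term.val_iso {A B : PreStruct σ W} (e : A.Iso B) : ∀ {i : S.Idx} (t : Term σ W P i)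
    {β : ℕ → A.Carrier} {γ : ℕ → B.Carrier}, (∀ z ∈ t.free, e.equiv (β z) = γ z) →
      t.val A β = t.val B γ
  | _, .const _ s, β, γ, h => by simp only [Term.val]
  | _, .wt w xs, β, γ, h => by
      simp only [Term.val]
      exact e.wt_congr fun i => h (xs i) (by simp [Term.free])
  | _, .add _ t u, β, γ, h => by
      simp only [Term.val]
      rw [Term.val_iso e t fun z hz => h z (by simp [Term.free, hz]),
        Term.val_iso e u fun z hz => h z (by simp [Term.free, hz])]
  | _, .sub _ t u, β, γ, h => by
      simp only [Term.val]
      rw [Term.val_iso e t fun z hz => h z (by simp [Term.free, hz]),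
        Term.val_iso e u fun z hz => h z (by simp [Term.free, hz])]
  | _, .mul _ t u, β, γ, h => by
      simp only [Term.val]
      rw [Term.val_iso e t fun z hz => h z (by simp [Term.free, hz]),
        Term.val_iso e u fun z hz => h z (by simp [Term.free, hz])]
  | _, .sum _ p φ, β, γ, h => by
      simp only [Term.val]
      have : ∀ a : p.vars → A.Carrier,
          (φ.Sat A (override β _ a) ↔ φ.Sat B (override γ _ (e.equiv ∘ a))) := fun a =>
        Formula.sat_iso e φ (override_iso e.equiv (by simpa only [Term.free] using h) a)
      refine Fintype.sum_equiv (Equiv.arrowCongr (Equiv.refl _) e.equiv) _ _ fun a => ?_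
      have h2 : Equiv.arrowCongr (Equiv.refl _) e.equiv a = e.equiv ∘ a := rfl
      rw [h2, p.val_iso e (override_iso_of_mem e.equiv β γ a)]
      classical exact if_congr (this a) rfl rfl
end

/-- Satisfaction depends only on the values of the free variables. -/
theorem Formula.sat_congr {A : PreStruct σ W} (φ : Formula σ W P) {β γ : ℕ → A.Carrier}
    (h : ∀ z ∈ φ.free, β z = γ z) : φ.Sat A β ↔ φ.Sat A γ :=
  φ.sat_iso (PreStruct.Iso.refl A) h

/-! ## Disjoint unions and local formulas -/

theorem PreStruct.edist_le_one_of_mem_rel (A : PreStruct σ W) {R : σ.Rel}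
    {t : Fin (σ.ar R) → A.Carrier} (ht : t ∈ A.rel R) {a b : A.Carrier}
    (ha : a ∈ Set.range t) (hb : b ∈ Set.range t) : A.gaifman.edist a b ≤ 1 := by
  rw [SimpleGraph.edist_le_one_iff_adj_or_eq]
  by_cases h : a = b
  · exact Or.inr h
  · exact Or.inl ⟨h, R, t, ht, ha, hb⟩

/-- Entries of a tuple with nonzero weight are equal or adjacent. -/
theorem WStruct.edist_le_one_of_wt_ne_zero (A : WStruct σ W) {w : W.Sym}
    {a : Fin (W.ar w) → A.Carrier} (ha : A.wt w a ≠ 0) (i j : Fin (W.ar w)) :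
    A.gaifman.edist (a i) (a j) ≤ 1 := by
  rcases A.wt_local w a ha with h | h | ⟨R, b, hb, hab⟩
  · have : i = j := by
      apply Fin.ext
      have := i.2
      have := j.2
      omega
    simp [this]
  · simp [h i j]
  · exact A.edist_le_one_of_mem_rel hb (hab ⟨i, rfl⟩) (hab ⟨j, rfl⟩)

theorem PreStruct.disjUnion_wt_inl (A B : PreStruct σ W) (w : W.Sym)
    (a : Fin (W.ar w) → A.Carrier) : (A.disjUnion B).wt w (Sum.inl ∘ a) = A.wt w a := by
  have h : ∃ a' : Fin (W.ar w) → A.Carrier,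
      (Sum.inl ∘ a : Fin (W.ar w) → A.Carrier ⊕ B.Carrier) = Sum.inl ∘ a' := ⟨a, rfl⟩
  have h2 : h.choose = a := (Sum.inl_injective.comp_left h.choose_spec).symm
  simp only [PreStruct.disjUnion]
  rw [dif_pos h, h2]

theorem PreStruct.disjUnion_wt_inr (A B : PreStruct σ W) (w : W.Sym)
    (b : Fin (W.ar w) → B.Carrier) : (A.disjUnion B).wt w (Sum.inr ∘ b) = B.wt w b := by
  have h : ∃ b' : Fin (W.ar w) → B.Carrier,
      (Sum.inr ∘ b : Fin (W.ar w) → A.Carrier ⊕ B.Carrier) = Sum.inr ∘ b' := ⟨b, rfl⟩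
  have h2 : h.choose = b := (Sum.inr_injective.comp_left h.choose_spec).symm
  -- This needs the arity to be positive: an empty tuple would factor through both inclusions.
  have h3 : ¬ ∃ a' : Fin (W.ar w) → A.Carrier,
      (Sum.inr ∘ b : Fin (W.ar w) → A.Carrier ⊕ B.Carrier) = Sum.inl ∘ a' := by
    rintro ⟨a', ha'⟩
    have := congrFun ha' ⟨0, W.ar_pos w⟩
    simp at this
  simp only [PreStruct.disjUnion]
  rw [dif_neg h3, dif_pos h, h2]

theorem PreStruct.disjUnion_wt_mixed (A B : PreStruct σ W) (w : W.Sym)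
    (t : Fin (W.ar w) → A.Carrier ⊕ B.Carrier) (h₁ : ¬ ∃ a : Fin (W.ar w) → A.Carrier,
      t = Sum.inl ∘ a) (h₂ : ¬ ∃ b : Fin (W.ar w) → B.Carrier, t = Sum.inr ∘ b) :
    (A.disjUnion B).wt w t = 0 := by
  simp only [PreStruct.disjUnion]
  rw [dif_neg h₁, dif_neg h₂]

theorem Sum.exists_inl_comp {ι α β : Type} (t : ι → α ⊕ β) (h : ∀ i, (t i).isLeft) :
    ∃ a : ι → α, t = Sum.inl ∘ a :=
  ⟨fun i => (t i).getLeft (h i), funext fun i => by simp⟩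

theorem Sum.exists_inr_comp {ι α β : Type} (t : ι → α ⊕ β) (h : ∀ i, (t i).isRight) :
    ∃ b : ι → β, t = Sum.inr ∘ b :=
  ⟨fun i => (t i).getRight (h i), funext fun i => by simp⟩

/-- A tuple in a disjoint union lies in one side or has entries in both. -/
theorem Sum.trichotomy {ι α β : Type} (t : ι → α ⊕ β) : (∃ a : ι → α, t = Sum.inl ∘ a) ∨
    (∃ b : ι → β, t = Sum.inr ∘ b) ∨ ∃ i j a b, t i = Sum.inl a ∧ t j = Sum.inr b := by
  by_cases h₁ : ∀ i, (t i).isLeft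
  · exact Or.inl (Sum.exists_inl_comp t h₁)
  by_cases h₂ : ∀ i, (t i).isRight
  · exact Or.inr (Or.inl (Sum.exists_inr_comp t h₂))
  push Not at h₁ h₂
  obtain ⟨j, hj⟩ := h₁
  obtain ⟨i, hi⟩ := h₂
  simp only [Bool.not_eq_true, Sum.isLeft_eq_false, Sum.isRight_eq_false, Sum.isRight_iff,
    Sum.isLeft_iff] at hi hj
  obtain ⟨a, ha⟩ := hi
  obtain ⟨b, hb⟩ := hj
  exact Or.inr (Or.inr ⟨i, j, a, b, ha, hb⟩)

/-- The disjoint union of weighted structures as a weighted structure. -/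
def WStruct.disjUnion (A B : WStruct σ W) : WStruct σ W where
  toPreStruct := A.toPreStruct.disjUnion B.toPreStruct
  wt_local w t ht := by
    by_cases h₁ : ∃ a : Fin (W.ar w) → A.Carrier, t = Sum.inl ∘ a
    · obtain ⟨a, rfl⟩ := h₁
      replace ht := (PreStruct.disjUnion_wt_inl A.toPreStruct B.toPreStruct w a).symm.trans_ne ht
      rcases A.wt_local w a ht with h | h | ⟨R, b, hb, hab⟩
      · exact Or.inl h
      · exact Or.inr (Or.inl fun i j => congrArg Sum.inl (h i j))
      · refine Or.inr (Or.inr ⟨R, Sum.inl ∘ b, Or.inl ⟨b, hb, rfl⟩, ?_⟩)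
        rintro _ ⟨i, rfl⟩
        obtain ⟨j, hj⟩ := hab ⟨i, rfl⟩
        exact ⟨j, congrArg Sum.inl hj⟩
    by_cases h₂ : ∃ b : Fin (W.ar w) → B.Carrier, t = Sum.inr ∘ b
    · obtain ⟨a, rfl⟩ := h₂
      replace ht := (PreStruct.disjUnion_wt_inr A.toPreStruct B.toPreStruct w a).symm.trans_ne ht
      rcases B.wt_local w a ht with h | h | ⟨R, b, hb, hab⟩
      · exact Or.inl h
      · exact Or.inr (Or.inl fun i j => congrArg Sum.inr (h i j))
      · refine Or.inr (Or.inr ⟨R, Sum.inr ∘ b, Or.inr ⟨b, hb, rfl⟩, ?_⟩)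
        rintro _ ⟨i, rfl⟩
        obtain ⟨j, hj⟩ := hab ⟨i, rfl⟩
        exact ⟨j, congrArg Sum.inr hj⟩
    · exact absurd (PreStruct.disjUnion_wt_mixed _ _ w t h₁ h₂) ht

theorem SimpleGraph.Hom.edist_le {V V' : Type} {G : SimpleGraph V} {G' : SimpleGraph V'}
    (f : G →g G') (u v : V) : G'.edist (f u) (f v) ≤ G.edist u v := by
  by_cases h : G.edist u v = ⊤
  · simp [h]
  · obtain ⟨p, hp⟩ := SimpleGraph.exists_walk_of_edist_ne_top h
    rw [← hp, ← p.length_map f]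
    exact SimpleGraph.edist_le _

-- Balls in two disjoint copies of a structure.

section

variable (A : PreStruct σ W)

/-- The projection from two disjoint copies of `A` to `A`. -/
def PreStruct.unfold : (A.disjUnion A).Carrier → A.Carrier := Sum.elim id id

/-- The projection is a homomorphism of Gaifman graphs. -/
def PreStruct.unfoldHom : (A.disjUnion A).gaifman →g A.gaifman where
  toFun := A.unfold
  map_rel' := by
    rintro u v ⟨hne, R, t, ht, hu, hv⟩
    rcases ht with ⟨a, ha, rfl⟩ | ⟨a, ha, rfl⟩
    · obtain ⟨i, rfl⟩ := hu
      obtain ⟨j, rfl⟩ := hv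
      exact ⟨fun h => hne (congrArg Sum.inl h), R, a, ha, ⟨i, rfl⟩, ⟨j, rfl⟩⟩
    · obtain ⟨i, rfl⟩ := hu
      obtain ⟨j, rfl⟩ := hv
      exact ⟨fun h => hne (congrArg Sum.inr h), R, a, ha, ⟨i, rfl⟩, ⟨j, rfl⟩⟩

/-- The first inclusion as a homomorphism of Gaifman graphs. -/
def PreStruct.inlHom : A.gaifman →g (A.disjUnion A).gaifman where
  toFun := Sum.inl
  map_rel' := by
    rintro u v ⟨hne, R, t, ht, ⟨i, rfl⟩, ⟨j, rfl⟩⟩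
    exact ⟨fun h => hne (Sum.inl_injective h), R, Sum.inl ∘ t, Or.inl ⟨t, ht, rfl⟩, ⟨i, rfl⟩,
      ⟨j, rfl⟩⟩

/-- The second inclusion as a homomorphism of Gaifman graphs. -/
def PreStruct.inrHom : A.gaifman →g (A.disjUnion A).gaifman where
  toFun := Sum.inr
  map_rel' := by
    rintro u v ⟨hne, R, t, ht, ⟨i, rfl⟩, ⟨j, rfl⟩⟩
    exact ⟨fun h => hne (Sum.inr_injective h), R, Sum.inr ∘ t, Or.inr ⟨t, ht, rfl⟩, ⟨i, rfl⟩,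
      ⟨j, rfl⟩⟩

theorem PreStruct.ball_union (r : ℕ) (X Y : Set A.Carrier) :
    A.ball r (X ∪ Y) = A.ball r X ∪ A.ball r Y := by
  ext b
  simp only [PreStruct.ball, Set.mem_union, Set.mem_ofPred_eq, or_and_right, exists_or]

end

theorem PreStruct.isLeft_eq_of_adj {A B : PreStruct σ W} {u v : A.Carrier ⊕ B.Carrier}
    (h : (A.disjUnion B).gaifman.Adj u v) : u.isLeft = v.isLeft := by
  obtain ⟨-, R, t, ⟨a, -, rfl⟩ | ⟨a, -, rfl⟩, ⟨i, rfl⟩, ⟨j, rfl⟩⟩ := h <;> rfl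

theorem PreStruct.isLeft_eq_of_edist_ne_top {A B : PreStruct σ W} {u v : A.Carrier ⊕ B.Carrier}
    (h : (A.disjUnion B).gaifman.edist u v ≠ ⊤) : u.isLeft = v.isLeft := by
  obtain ⟨p, -⟩ := SimpleGraph.exists_walk_of_edist_ne_top h
  clear h
  induction p with
  | nil => rfl
  | cons h _ ih => exact (PreStruct.isLeft_eq_of_adj h).trans ih

/-- Walks in a disjoint union stay on one side. Both the inclusion and the projection are graph
homomorphisms and hence do not increase distances, so balls are computed separately in each copy. -/
theorem PreStruct.inl_mem_ball {A : PreStruct σ W} {r : ℕ} {X Y : Set A.Carrier} {a : A.Carrier} :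
    (Sum.inl a : A.Carrier ⊕ A.Carrier) ∈ (A.disjUnion A).ball r (Sum.inl '' X ∪ Sum.inr '' Y) ↔
      a ∈ A.ball r X := by
  constructor
  · rintro ⟨u, hu, hd⟩
    have := PreStruct.isLeft_eq_of_edist_ne_top
      (ne_top_of_le_ne_top (ENat.natCast_ne_top r) hd)
    rcases hu with ⟨c, hc, rfl⟩ | ⟨c, hc, rfl⟩
    · exact ⟨c, hc, (SimpleGraph.Hom.edist_le A.unfoldHom _ _).trans hd⟩
    · simp at this
  · rintro ⟨c, hc, hd⟩
    exact ⟨Sum.inl c, Or.inl ⟨c, hc, rfl⟩, (SimpleGraph.Hom.edist_le A.inlHom _ _).trans hd⟩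

theorem PreStruct.inr_mem_ball {A : PreStruct σ W} {r : ℕ} {X Y : Set A.Carrier} {a : A.Carrier} :
    (Sum.inr a : A.Carrier ⊕ A.Carrier) ∈ (A.disjUnion A).ball r (Sum.inl '' X ∪ Sum.inr '' Y) ↔
      a ∈ A.ball r Y := by
  constructor
  · rintro ⟨u, hu, hd⟩
    have := PreStruct.isLeft_eq_of_edist_ne_top
      (ne_top_of_le_ne_top (ENat.natCast_ne_top r) hd)
    rcases hu with ⟨c, hc, rfl⟩ | ⟨c, hc, rfl⟩
    · simp at this
    · exact ⟨c, hc, (SimpleGraph.Hom.edist_le A.unfoldHom _ _).trans hd⟩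
  · rintro ⟨c, hc, hd⟩
    exact ⟨Sum.inr c, Or.inr ⟨c, hc, rfl⟩, (SimpleGraph.Hom.edist_le A.inrHom _ _).trans hd⟩

/-- The triangle inequality through the two centres: `r + 1 + r` is the distance that the hypothesis
excludes. The strict bound `1 <` says that points of the two balls are neither equal nor adjacent,
which is what rules out mixed tuples and weights. -/
theorem PreStruct.one_lt_edist_of_mem_ball {A : PreStruct σ W} {r : ℕ} {X Y : Set A.Carrier}
    (hXY : ∀ u ∈ X, ∀ v ∈ Y, ((2 * r + 1 : ℕ) : ℕ∞) < A.gaifman.edist u v) {a b : A.Carrier}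
    (ha : a ∈ A.ball r X) (hb : b ∈ A.ball r Y) : 1 < A.gaifman.edist a b := by
  obtain ⟨u, hu, hua⟩ := ha
  obtain ⟨v, hv, hvb⟩ := hb
  by_contra hab
  push Not at hab
  refine absurd (hXY u hu v hv) (not_lt.2 ?_)
  calc A.gaifman.edist u v ≤ A.gaifman.edist u a + A.gaifman.edist a v :=
        SimpleGraph.edist_triangle
    _ ≤ A.gaifman.edist u a + (A.gaifman.edist a b + A.gaifman.edist b v) := by
        gcongr
        exact SimpleGraph.edist_triangle
    _ ≤ r + (1 + r) := by
        gcongr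
        rwa [SimpleGraph.edist_comm]
    _ = ((2 * r + 1 : ℕ) : ℕ∞) := by
        push_cast
        ring

/-- If `X` and `Y` are far apart then the neighbourhood of `X ∪ Y` in `A` is isomorphic to the
neighbourhood of `X ⊔ Y` in the disjoint union of two copies of `A`. -/
def WStruct.nbhdIso (A : WStruct σ W) {r : ℕ} {X Y : Set A.Carrier}
    (hXY : ∀ u ∈ X, ∀ v ∈ Y, ((2 * r + 1 : ℕ) : ℕ∞) < A.gaifman.edist u v)
    (h : (X ∪ Y).Nonempty) (h' : (Sum.inl '' X ∪ Sum.inr '' Y : Set (A.Carrier ⊕ A.Carrier)).Nonempty) :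
    PreStruct.Iso
      ((A.toPreStruct.disjUnion A.toPreStruct).nbhd r (Sum.inl '' X ∪ Sum.inr '' Y) h')
      (A.toPreStruct.nbhd r (X ∪ Y) h) where
  equiv := Equiv.ofBijective
    (fun u => ⟨A.unfold u.1, by
      obtain ⟨u | u, hu⟩ := u
      · exact (PreStruct.ball_union _ _ _ _).ge (Or.inl (PreStruct.inl_mem_ball.1 hu))
      · exact (PreStruct.ball_union _ _ _ _).ge (Or.inr (PreStruct.inr_mem_ball.1 hu))⟩) (by
    constructor
    · rintro ⟨u | u, hu⟩ ⟨v | v, hv⟩ huv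
      · exact Subtype.ext (congrArg Sum.inl (congrArg Subtype.val huv))
      -- Points from different copies with the same projection would lie in both balls, at distance
      -- 0 from themselves.
      · have h1 : u = v := congrArg Subtype.val huv
        have := PreStruct.one_lt_edist_of_mem_ball hXY (PreStruct.inl_mem_ball.1 hu)
          (PreStruct.inr_mem_ball.1 hv)
        simp [h1] at this
      · have h1 : u = v := congrArg Subtype.val huv
        have := PreStruct.one_lt_edist_of_mem_ball hXY (PreStruct.inl_mem_ball.1 hv)
          (PreStruct.inr_mem_ball.1 hu)
        simp [h1] at this
      · exact Subtype.ext (congrArg Sum.inr (congrArg Subtype.val huv))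
    · rintro ⟨a, ha⟩
      rcases (PreStruct.ball_union _ _ _ _).le ha with h | h
      · exact ⟨⟨Sum.inl a, PreStruct.inl_mem_ball.2 h⟩, rfl⟩
      · exact ⟨⟨Sum.inr a, PreStruct.inr_mem_ball.2 h⟩, rfl⟩)
  rel_iff R t := by
    change (fun i => A.unfold (t i).1) ∈ A.rel R ↔
      (fun i => (t i).1) ∈ (A.toPreStruct.disjUnion A.toPreStruct).rel R
    rcases Sum.trichotomy fun i => (t i).1 with ⟨a, ha⟩ | ⟨a, ha⟩ | ⟨i, j, a, b, hi, hj⟩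
    · have h1 : ∀ i, (t i).1 = Sum.inl (a i) := fun i => congrFun ha i
      simp only [h1]
      constructor
      · exact fun h => Or.inl ⟨a, h, rfl⟩
      · rintro (⟨c, hc, hac⟩ | ⟨c, hc, hac⟩)
        · rwa [show a = c from Sum.inl_injective.comp_left hac]
        -- A tuple that comes from both copies is empty. This occurs for relations of arity 0, where
        -- all tuples coincide.
        · have : ∀ i, False := fun i => by simpa using congrFun hac i
          convert hc using 1
          exact funext fun i => (this i).elim
    · have h1 : ∀ i, (t i).1 = Sum.inr (a i) := fun i => congrFun ha i
      simp only [h1]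
      constructor
      · exact fun h => Or.inr ⟨a, h, rfl⟩
      · rintro (⟨c, hc, hac⟩ | ⟨c, hc, hac⟩)
        · have : ∀ i, False := fun i => by simpa using congrFun hac i
          convert hc using 1
          exact funext fun i => (this i).elim
        · rwa [show a = c from Sum.inr_injective.comp_left hac]
    · have h1 := PreStruct.one_lt_edist_of_mem_ball hXY
        (PreStruct.inl_mem_ball.1 (hi ▸ (t i).2)) (PreStruct.inr_mem_ball.1 (hj ▸ (t j).2))
      constructor
      · intro h
        refine absurd (A.edist_le_one_of_mem_rel h (a := a) (b := b) ⟨i, ?_⟩ ⟨j, ?_⟩) (not_le.2 h1)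
        · simp only [hi]; rfl
        · simp only [hj]; rfl
      · rintro (⟨c, hc, hac⟩ | ⟨c, hc, hac⟩)
        · have := congrFun hac j
          simp [hj] at this
        · have := congrFun hac i
          simp [hi] at this
  wt_eq w t := by
    change A.wt w (fun i => A.unfold (t i).1) =
      (A.toPreStruct.disjUnion A.toPreStruct).wt w fun i => (t i).1
    rcases Sum.trichotomy fun i => (t i).1 with ⟨a, ha⟩ | ⟨a, ha⟩ | ⟨i, j, a, b, hi, hj⟩
    · refine Eq.trans ?_ ((congrArg _ ha).trans (PreStruct.disjUnion_wt_inl _ _ w a)).symm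
      have h1 : ∀ i, (t i).1 = Sum.inl (a i) := fun i => congrFun ha i
      simp only [h1]
      rfl
    · refine Eq.trans ?_ ((congrArg _ ha).trans (PreStruct.disjUnion_wt_inr _ _ w a)).symm
      have h1 : ∀ i, (t i).1 = Sum.inr (a i) := fun i => congrFun ha i
      simp only [h1]
      rfl
    · have h1 := PreStruct.one_lt_edist_of_mem_ball hXY
        (PreStruct.inl_mem_ball.1 (hi ▸ (t i).2)) (PreStruct.inr_mem_ball.1 (hj ▸ (t j).2))
      refine Eq.trans ?_ (PreStruct.disjUnion_wt_mixed _ _ w _ ?_ ?_).symm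
      -- Here the locality condition on weights enters: a nonzero weight would force the entries `i`
      -- and `j` within distance 1.
      · by_contra hne
        have := A.edist_le_one_of_wt_ne_zero hne i j
        simp only [hi, hj] at this
        exact absurd this (not_le.2 h1)
      · rintro ⟨c, hac⟩
        have := congrFun hac j
        simp [hj] at this
      · rintro ⟨c, hac⟩
        have := congrFun hac i
        simp [hi] at this

/-- The centres are given by equations, so that images of assignments can be inserted without
rewriting inside the dependent type of a neighbourhood. -/
theorem WStruct.exists_nbhdIso (A : WStruct σ W) {r : ℕ} {X Y : Set A.Carrier}
    (hXY : ∀ u ∈ X, ∀ v ∈ Y, ((2 * r + 1 : ℕ) : ℕ∞) < A.gaifman.edist u v)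
    {V : Set A.Carrier} (h : V.Nonempty) (hV : V = X ∪ Y)
    {U : Set (A.disjUnion A).Carrier} (h' : U.Nonempty) (hU : U = Sum.inl '' X ∪ Sum.inr '' Y) :
    ∃ e : PreStruct.Iso ((A.disjUnion A).nbhd r U h') (A.nbhd r V h),
      ∀ u, (e.equiv u).1 = A.unfold u.1 := by
  subst hV hU
  exact ⟨A.nbhdIso hXY h h', fun u => rfl⟩

/-- A local formula whose free variables fall into two parts with values far apart is satisfied
in `A` iff it is satisfied with the two parts placed in two disjoint copies of `A`. -/
theorem Formula.IsLocal.sat_disjUnion_iff {r : ℕ} {φ : Formula σ W P} (hφ : φ.IsLocal r)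
    (A : WStruct σ W) (β : ℕ → A.Carrier) {Z Z' : Finset ℕ} (hdisj : Disjoint Z Z')
    (hZ : Z ∪ Z' = φ.free) (hne : φ.free.Nonempty)
    (hfar : ∀ u ∈ Z, ∀ v ∈ Z', ((2 * r + 1 : ℕ) : ℕ∞) < A.gaifman.edist (β u) (β v)) :
    φ.Sat A.toPreStruct β ↔ φ.Sat (A.toPreStruct.disjUnion A.toPreStruct)
      (fun z => if z ∈ Z then Sum.inl (β z) else Sum.inr (β z)) := by
  set βU : ℕ → (A.disjUnion A).Carrier :=
    fun z => if z ∈ Z then Sum.inl (β z) else Sum.inr (β z) with hβU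
  have h1 : β '' (φ.free : Set ℕ) = β '' Z ∪ β '' Z' := by
    rw [← hZ, Finset.coe_union, Set.image_union]
  have h2 : βU '' (φ.free : Set ℕ) = Sum.inl '' (β '' Z) ∪ Sum.inr '' (β '' Z') := by
    rw [← hZ, Finset.coe_union, Set.image_union, Set.image_image, Set.image_image]
    congr 1
    · exact Set.image_congr fun z hz => if_pos hz
    · refine Set.image_congr fun z hz => ?_
      have : z ∉ Z := fun h => Finset.disjoint_left.1 hdisj h hz
      exact if_neg this
  have hn1 : (β '' (φ.free : Set ℕ)).Nonempty := hne.to_set.image _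
  have hn2 : (βU '' (φ.free : Set ℕ)).Nonempty := hne.to_set.image _
  obtain ⟨e, he⟩ := A.exists_nbhdIso (r := r) (X := β '' Z) (Y := β '' Z') (by
    rintro _ ⟨u, hu, rfl⟩ _ ⟨v, hv, rfl⟩
    exact hfar u hu v hv) hn1 h1 hn2 h2
  -- Only the values at free variables matter; the arbitrary values elsewhere merely make the
  -- assignments total.
  let β' : ℕ → (A.nbhd r (β '' (φ.free : Set ℕ)) hn1).Carrier := fun z =>
    if hz : z ∈ φ.free then ⟨β z, A.subset_ball _ _ ⟨z, hz, rfl⟩⟩ else Classical.arbitrary _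
  let βU' : ℕ → ((A.disjUnion A).nbhd r (βU '' (φ.free : Set ℕ)) hn2).Carrier := fun z =>
    if hz : z ∈ φ.free then ⟨βU z, (A.disjUnion A).subset_ball _ _ ⟨z, hz, rfl⟩⟩
    else Classical.arbitrary _
  have hβ' : ∀ z ∈ φ.free, (β' z).1 = β z := fun z hz => by simp [β', hz]
  have hβU' : ∀ z ∈ φ.free, (βU' z).1 = βU z := fun z hz => by simp [βU', hz]
  -- Locality is used twice, in `A` and in the disjoint union of two copies; `e` identifies the two
  -- neighbourhoods.
  rw [hφ A β hn1 β' hβ']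
  refine Iff.trans ?_ (hφ (A.disjUnion A) βU hn2 βU' hβU').symm
  refine (φ.sat_iso e fun z hz => Subtype.ext ?_).symm
  rw [he, hβ' z hz, hβU' z hz]
  by_cases h : z ∈ Z
  · exact congrArg A.unfold (if_pos h)
  · exact congrArg A.unfold (if_neg h)

/-! ## Parameters near the training examples suffice -/

theorem PreStruct.ball_mono (A : PreStruct σ W) {r s : ℕ} (h : r ≤ s) (B : Set A.Carrier) :
    A.ball r B ⊆ A.ball s B :=
  fun _ ⟨a, ha, hd⟩ => ⟨a, ha, hd.trans (by exact_mod_cast h)⟩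

theorem PreStruct.mem_ball_add (A : PreStruct σ W) {r s : ℕ} {B : Set A.Carrier}
    {a b : A.Carrier} (ha : a ∈ A.ball r B) (hab : A.gaifman.edist a b ≤ s) :
    b ∈ A.ball (r + s) B := by
  obtain ⟨c, hc, hd⟩ := ha
  refine ⟨c, hc, SimpleGraph.edist_triangle.trans ((add_le_add hd hab).trans ?_)⟩
  push_cast
  exact le_rfl

/-- Finitely many points leave one of the annuli around `X` empty. -/
theorem PreStruct.exists_empty_annulus (A : PreStruct σ W) (X : Set A.Carrier) {ℓ : ℕ} (q : ℕ)
    (v : Fin ℓ → A.Carrier) :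
    ∃ j ≤ ℓ, ∀ m, v m ∈ A.ball (q * j) X ∨ v m ∉ A.ball (q * (j + 1)) X := by
  by_contra hcon
  push Not at hcon
  choose m hm using fun j : Fin (ℓ + 1) => hcon j (Nat.lt_succ_iff.1 j.2)
  -- Pigeonhole: `ℓ + 1` annuli, each containing one of `ℓ` points, so one point lies in two of
  -- them. But the outer ball of the smaller annulus is contained in the hole of the larger one.
  obtain ⟨i, j, hij, he⟩ := Fintype.exists_ne_map_eq_of_card_lt m (by simp)
  rcases lt_or_gt_of_ne hij with h | h
  · exact (hm j).1 (he ▸ A.ball_mono (Nat.mul_le_mul_left q h) X (hm i).2)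
  · exact (hm i).1 (he ▸ A.ball_mono (Nat.mul_le_mul_left q h) X (hm j).2)

theorem assign_left {α : Type} [Nonempty α] {k ℓ : ℕ} {x : Fin k → ℕ} {y : Fin ℓ → ℕ}
    (hxy : Function.Injective (Sum.elim x y)) (a : Fin k → α) (v : Fin ℓ → α) (i : Fin k) :
    assign x y a v (x i) = a i :=
  hxy.extend_apply (Sum.elim a v) _ (Sum.inl i)

theorem assign_right {α : Type} [Nonempty α] {k ℓ : ℕ} {x : Fin k → ℕ} {y : Fin ℓ → ℕ}
    (hxy : Function.Injective (Sum.elim x y)) (a : Fin k → α) (v : Fin ℓ → α) (i : Fin ℓ) :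
    assign x y a v (y i) = v i :=
  hxy.extend_apply (Sum.elim a v) _ (Sum.inr i)

/-- Finite disjunctions exist in a non-empty set closed under Boolean combinations. -/
theorem ClosedUnderBool.exists_disjunction {Φ : Set (Formula σ W P)} (hne : Φ.Nonempty)
    (hbool : ClosedUnderBool Φ) {F : Set (Formula σ W P)} (hF : F.Finite) (hFΦ : F ⊆ Φ) :
    ∃ ψ ∈ Φ, ∀ (A : WStruct σ W) (β : ℕ → A.Carrier),
      ψ.Sat A.toPreStruct β ↔ ∃ α ∈ F, α.Sat A.toPreStruct β := by
  induction F, hF using Set.Finite.induction_on with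
  | empty =>
    -- The empty disjunction is represented by the negation of `φ ∨ ¬φ`.
    obtain ⟨φ, hφ⟩ := hne
    obtain ⟨φ', hφ', h1⟩ := hbool.1 φ hφ
    obtain ⟨ψ, hψ, h2⟩ := hbool.2 φ hφ φ' hφ'
    obtain ⟨ψ', hψ', h3⟩ := hbool.1 ψ hψ
    refine ⟨ψ', hψ', fun A β => ?_⟩
    rw [h3 A β]
    simp only [Formula.Sat]
    rw [h2 A β]
    simp only [Formula.Sat]
    rw [h1 A β]
    simp only [Formula.Sat, Set.mem_empty_iff_false, false_and, exists_false, iff_false]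
    exact not_not.2 (em _)
  | @insert α F _ _ ih =>
    obtain ⟨ψ, hψ, h⟩ := ih ((Set.subset_insert _ _).trans hFΦ)
    obtain ⟨ψ', hψ', h'⟩ := hbool.2 α (hFΦ (Set.mem_insert _ _)) ψ hψ
    refine ⟨ψ', hψ', fun A β => ?_⟩
    rw [h' A β]
    simp only [Formula.Sat]
    rw [h A β]
    simp

/-- On given examples, every hypothesis agrees with one whose parameters are near the
examples. -/
theorem exists_near_hypothesis {k ℓ : ℕ} {x : Fin k → ℕ} {y : Fin ℓ → ℕ}
    (hxy : Function.Injective (Sum.elim x y)) {r : ℕ} {Φ : Set (Formula σ W P)}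
    (hfree : ∀ φ ∈ Φ, (φ.free : Set ℕ) ⊆ Set.range x ∪ Set.range y)
    (hlocal : ∀ φ ∈ Φ, φ.IsLocal r) (hFV : ClosedUnderFV Φ) (hbool : ClosedUnderBool Φ)
    (A : WStruct σ W) {X : Set A.Carrier} (hX : X.Nonempty ∨ ℓ = 0)
    {φ : Formula σ W P} (hφ : φ ∈ Φ) (v : Fin ℓ → A.Carrier) :
    ∃ φ' ∈ Φ, ∃ v' : Fin ℓ → A.Carrier, (∀ j, v' j ∈ A.ball ((2 * r + 1) * ℓ) X) ∧
      ∀ a : Fin k → A.Carrier, (∀ i, a i ∈ X) →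
        (φ.Sat A.toPreStruct (assign x y a v) ↔ φ'.Sat A.toPreStruct (assign x y a v')) := by
  classical
  rcases hX with ⟨x₀, hx₀⟩ | rfl
  swap
  · exact ⟨φ, hφ, v, fun j => j.elim0, fun a _ => Iff.rfl⟩
  obtain ⟨j, hjℓ, hj⟩ := A.exists_empty_annulus X (2 * r + 1) v
  set N : Set (Fin ℓ) := {m | v m ∈ A.ball ((2 * r + 1) * j) X} with hN
  -- The new formula does not depend on the far parameters, so any element close to the examples can
  -- stand in for them.
  let v' : Fin ℓ → A.Carrier := fun m => if m ∈ N then v m else x₀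
  have hv' : ∀ m, v' m ∈ A.ball ((2 * r + 1) * ℓ) X := by
    intro m
    by_cases hm : m ∈ N
    · simpa [v', hm] using A.ball_mono (Nat.mul_le_mul_left _ hjℓ) X hm
    · simpa [v', hm] using A.subset_ball _ X hx₀
  let Z' := φ.free.filter fun z => ∃ m, m ∉ N ∧ y m = z
  let Z := φ.free \ Z'
  have hZ : ∀ z ∈ Z, (∃ i, x i = z) ∨ ∃ m ∈ N, y m = z := by
    intro z hz
    obtain ⟨h1, h2⟩ := Finset.mem_sdiff.1 hz
    rcases hfree φ hφ h1 with ⟨i, hi⟩ | ⟨m, hm⟩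
    · exact Or.inl ⟨i, hi⟩
    · refine Or.inr ⟨m, by_contra fun hmN => h2 (Finset.mem_filter.2 ⟨h1, m, hmN, hm⟩), hm⟩
  have hcongr : ∀ α : Formula σ W P, α.free ⊆ Z → ∀ a,
      (α.Sat A.toPreStruct (assign x y a v) ↔ α.Sat A.toPreStruct (assign x y a v')) := by
    refine fun α hα a => α.sat_congr fun z hz => ?_
    rcases hZ z (hα hz) with ⟨i, rfl⟩ | ⟨m, hm, rfl⟩
    · rw [assign_left hxy, assign_left hxy]
    · rw [assign_right hxy, assign_right hxy]
      simp [v', hm]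
  -- Without far variables `φ` itself works. This case also disposes of sentences, about which
  -- locality says nothing.
  by_cases hZ' : Z' = ∅
  · exact ⟨φ, hφ, v', hv', fun a _ => hcongr φ (by simp [Z, hZ']) a⟩
  have hdisj : Disjoint Z Z' := Finset.sdiff_disjoint
  have hunion : Z ∪ Z' = φ.free := Finset.sdiff_union_of_subset (Finset.filter_subset _ _)
  obtain ⟨Δ, hΔfin, -, hΔ, hΔsat⟩ := hFV φ hφ Z Z' hdisj hunion
  -- The far halves mention parameters only, so their truth values may be read off at an arbitrary
  -- example tuple. This makes the choice of disjuncts the same for all examples.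
  let a₀ : Fin k → A.Carrier := fun _ => x₀
  have hright : ∀ β : Formula σ W P, β.free ⊆ Z' → ∀ a,
      (β.Sat A.toPreStruct (assign x y a v) ↔ β.Sat A.toPreStruct (assign x y a₀ v)) := by
    refine fun β hβ a => β.sat_congr fun z hz => ?_
    obtain ⟨-, m, -, rfl⟩ := Finset.mem_filter.1 (hβ hz)
    rw [assign_right hxy, assign_right hxy]
  obtain ⟨ψ, hψ, hψsat⟩ := hbool.exists_disjunction ⟨φ, hφ⟩
    (F := Prod.fst '' {p ∈ Δ | p.2.Sat A.toPreStruct (assign x y a₀ v)})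
    ((hΔfin.subset (Set.sep_subset _ _)).image _) (by
      rintro _ ⟨p, hp, rfl⟩
      exact (hΔ p hp.1).1)
  refine ⟨ψ, hψ, v', hv', fun a ha => ?_⟩
  -- Near values lie in the ball of radius `(2 * r + 1) * j` and far ones outside radius `(2 * r +
  -- 1) * (j + 1)`; a short connection would put a far value inside the latter.
  have hfar : ∀ u ∈ Z, ∀ w ∈ Z', ((2 * r + 1 : ℕ) : ℕ∞) <
      A.gaifman.edist (assign x y a v u) (assign x y a v w) := by
    intro u hu w hw
    by_contra hle
    push Not at hle
    obtain ⟨-, m, hm, rfl⟩ := Finset.mem_filter.1 hw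
    have hmem : assign x y a v u ∈ A.ball ((2 * r + 1) * j) X := by
      rcases hZ u hu with ⟨i, rfl⟩ | ⟨m', hm', rfl⟩
      · rw [assign_left hxy]
        exact A.subset_ball _ X (ha i)
      · rw [assign_right hxy]
        exact hm'
    have := A.mem_ball_add hmem hle
    rw [assign_right hxy] at this
    rcases hj m with h | h
    · exact hm h
    · exact h (by rwa [mul_add, mul_one])
  have hne : φ.free.Nonempty :=
    (Finset.nonempty_iff_ne_empty.2 hZ').mono (Finset.filter_subset _ _)
  rw [(hlocal φ hφ).sat_disjUnion_iff A _ hdisj hunion hne hfar, hΔsat A A, hψsat A]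
  constructor
  · rintro ⟨p, hp, h1, h2⟩
    exact ⟨p.1, ⟨p, ⟨hp, (hright _ (hΔ p hp).2.2.2 a).1 h2⟩, rfl⟩,
      (hcongr _ (hΔ p hp).2.2.1 a).1 h1⟩
  · rintro ⟨_, ⟨p, ⟨hp, h2⟩, rfl⟩, h1⟩
    exact ⟨p, hp, (hcongr _ (hΔ p hp).2.2.1 a).2 h1, (hright _ (hΔ p hp).2.2.2 a).2 h2⟩

/-! ## Program combinators -/

/-- `Runs A nb c v b Q`: on input `v`, the program `c` stops within `b` steps with an output
satisfying `Q`. -/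
def Runs (A : PreStruct σ W) (nb : NbrOracle A) (c : Code σ W P) (v : Val σ W P A.Carrier) (b : ℕ)
    (Q : Val σ W P A.Carrier → Prop) : Prop :=
  ∃ u τ, Eval A nb c v u τ ∧ τ ≤ b ∧ Q u

namespace Val

/-- Triples of data. -/
def triple {α : Type} (u v w : Val σ W P α) : Val σ W P α := .pair u (.pair v w)

theorem ofList_map_cons {α δ : Type} (e : δ → Val σ W P α) (x : δ) (l : List δ) :
    Val.ofList ((x :: l).map e) = .pair (e x) (.ofList (l.map e)) := rfl

theorem tuple_cons {α : Type} {m : ℕ} (b : α) (p : Fin m → α) :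
    (Val.tuple (Fin.cons b p : Fin (m + 1) → α) : Val σ W P α) = .pair (.elem b) (.tuple p) := by
  simp [Val.tuple, List.ofFn_succ, Val.ofList]

theorem ofProp_ne_nil {α : Type} {p : Prop} (h : p) : (Val.ofProp p : Val σ W P α) ≠ .nil := by
  simp [Val.ofProp, h, Val.true]

theorem ofProp_eq_nil {α : Type} {p : Prop} (h : ¬ p) : (Val.ofProp p : Val σ W P α) = .nil := by
  simp [Val.ofProp, h, Val.false]

end Val

namespace Code

/-- The middle entry of a triple. -/
def mid : Code σ W P := .comp .head .tail

/-- The last entry of a triple. -/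
def last : Code σ W P := .comp .tail .tail

/-- Triples of programs. -/
def triple (f g h : Code σ W P) : Code σ W P := .pair f (.pair g h)

/-- On a triple `(ctx, acc, list)`, fold `step` over the list; `step` maps a triple
`(ctx, acc, x)` to the new value of `acc`. -/
def fold (step : Code σ W P) : Code σ W P :=
  .comp mid (.loop (.comp .isPair last)
    (triple .head (.comp step (triple .head mid (.comp .head last))) (.comp .tail last)))

/-- Append a list to a list of length `k`. -/
def append : ℕ → Code σ W P
  | 0 => .tail
  | k + 1 => .pair (.comp .head .head) (.comp (append k) (.pair (.comp .tail .head) .tail))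

/-- On `(ctx, acc, list)`, push the entries of the list to `acc`. -/
def pushAll : Code σ W P := fold (.pair last mid)

/-- On a pair of lists, test whether the first one is shorter. -/
def shorter : Code σ W P :=
  .comp (.comp .isPair .tail)
    (.loop (.ite (.comp .isPair .head) (.comp .isPair .tail) .nil)
      (.pair (.comp .tail .head) (.comp .tail .tail)))

end Code

-- Cost rules for the combinators.

section

variable {A : PreStruct σ W} {nb : NbrOracle A}

theorem Runs.mono {c : Code σ W P} {v : Val σ W P A.Carrier} {b b' : ℕ}
    {Q Q' : Val σ W P A.Carrier → Prop} (h : Runs A nb c v b Q) (hb : b ≤ b')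
    (hQ : ∀ u, Q u → Q' u) : Runs A nb c v b' Q' := by
  obtain ⟨u, τ, he, hτ, hu⟩ := h
  exact ⟨u, τ, he, hτ.trans hb, hQ u hu⟩

theorem Runs.comp {f g : Code σ W P} {v : Val σ W P A.Carrier} {b₁ b₂ : ℕ}
    {Q R : Val σ W P A.Carrier → Prop} (hg : Runs A nb g v b₁ Q)
    (hf : ∀ u, Q u → Runs A nb f u b₂ R) : Runs A nb (.comp f g) v (b₁ + b₂ + 1) R := by
  obtain ⟨u, τ, he, hτ, hu⟩ := hg
  obtain ⟨w, τ', he', hτ', hw⟩ := hf u hu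
  exact ⟨w, _, .comp he he', by omega, hw⟩

theorem Eval.runs_comp {f g : Code σ W P} {v u : Val σ W P A.Carrier} {b₁ b₂ : ℕ}
    {R : Val σ W P A.Carrier → Prop} (hg : Eval A nb g v u b₁)
    (hf : Runs A nb f u b₂ R) : Runs A nb (.comp f g) v (b₁ + b₂ + 1) R :=
  Runs.comp (Q := (· = u)) ⟨u, b₁, hg, le_rfl, rfl⟩ fun _ h => h ▸ hf

theorem Eval.isPair_nil : Eval A nb (.isPair : Code σ W P) .nil .nil 1 := by
  have := Eval.isPair (A := A) (nb := nb) (P := P) .nil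
  rwa [Val.ofProp_eq_nil (by simp)] at this

theorem Eval.head_triple (u v w : Val σ W P A.Carrier) :
    Eval A nb .head (.triple u v w) u 1 := .head _ _

theorem Eval.mid_triple (u v w : Val σ W P A.Carrier) :
    Eval A nb .mid (.triple u v w) v 3 := .comp (.tail _ _) (.head _ _)

theorem Eval.last_triple (u v w : Val σ W P A.Carrier) :
    Eval A nb .last (.triple u v w) w 3 := .comp (.tail _ _) (.tail _ _)

theorem Eval.triple {f g h : Code σ W P} {v u₁ u₂ u₃ : Val σ W P A.Carrier} {m n p : ℕ}
    (hf : Eval A nb f v u₁ m) (hg : Eval A nb g v u₂ n) (hh : Eval A nb h v u₃ p) :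
    Eval A nb (.triple f g h) v (.triple u₁ u₂ u₃) (m + (n + p + 1) + 1) :=
  .pair hf (.pair hg hh)

/-- The rule for loops over lists. -/
theorem Runs.fold {δ : Type} {e : δ → Val σ W P A.Carrier}
    {I : List δ → Val σ W P A.Carrier → Prop} {step : Code σ W P} {ctx : Val σ W P A.Carrier}
    {b : ℕ} (hstep : ∀ pre x acc, I pre acc →
      Runs A nb step (.triple ctx acc (e x)) b (I (pre ++ [x])))
    {acc : Val σ W P A.Carrier} (h₀ : I [] acc) (l : List δ) :
    Runs A nb (.fold step) (.triple ctx acc (.ofList (l.map e))) (l.length * (b + 26) + 10)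
      (I l) := by
  -- The loop is analysed for an arbitrary processed prefix `pre`, so that the induction on the
  -- remaining list can carry the invariant.
  have key : ∀ (l pre : List δ) (acc : Val σ W P A.Carrier), I pre acc →
      ∃ acc' τ, Eval A nb (.loop (.comp .isPair .last) (.triple .head
        (.comp step (.triple .head .mid (.comp .head .last))) (.comp .tail .last)))
        (.triple ctx acc (.ofList (l.map e))) (.triple ctx acc' .nil) τ ∧
        τ ≤ l.length * (b + 26) + 6 ∧ I (pre ++ l) acc' := by
    intro l
    induction l with
    | nil =>
      intro pre acc h
      exact ⟨acc, _, Eval.loop_stop (.comp (.last_triple _ _ _) .isPair_nil), by simp,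
        by simpa using h⟩
    | cons x l ih =>
      intro pre acc h
      obtain ⟨u, m, he, hm, hu⟩ := hstep pre x acc h
      obtain ⟨acc', τ, he', hτ, hacc'⟩ := ih (pre ++ [x]) u hu
      rw [Val.ofList_map_cons]
      refine ⟨acc', _, .loop_step (.comp (.last_triple _ _ _) (.isPair _))
        (Val.ofProp_ne_nil ⟨_, _, rfl⟩) (.triple (.head_triple _ _ _) (.comp (.triple
          (.head_triple _ _ _) (.mid_triple _ _ _) (.comp (.last_triple _ _ _) (.head _ _))) he)
          (.comp (.last_triple _ _ _) (.tail _ _))) he', ?_, by simpa using hacc'⟩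
      -- Besides the call of `step`, a round costs 26: 5 for the test, 20 for taking the triple
      -- apart and rebuilding it, 1 for the loop.
      rw [List.length_cons, Nat.add_mul]
      omega
  obtain ⟨acc', τ, he, hτ, h⟩ := key l [] acc h₀
  exact ⟨acc', _, .comp he (.mid_triple _ _ _), by omega, by simpa using h⟩

theorem Eval.append (us ws : List (Val σ W P A.Carrier)) :
    Eval A nb (.append us.length) (.pair (.ofList us) (.ofList ws)) (.ofList (us ++ ws))
      (10 * us.length + 1) := by
  induction us with
  | nil => exact .tail _ _
  | cons u us ih =>
    have := Eval.pair (.comp (.head _ _) (.head _ _))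
      (.comp (.pair (.comp (.head (Val.pair u (.ofList us)) (.ofList ws)) (.tail _ _)) (.tail _ _)) ih)
    rw [show 10 * (u :: us).length + 1 =
      1 + 1 + 1 + (1 + 1 + 1 + 1 + 1 + (10 * us.length + 1) + 1) + 1 by
        rw [List.length_cons]; omega]
    exact this

theorem Runs.pushAll {δ : Type} (e : δ → Val σ W P A.Carrier) (ctx : Val σ W P A.Carrier)
    (l₀ l : List δ) :
    Runs A nb .pushAll (.triple ctx (.ofList (l₀.map e)) (.ofList (l.map e)))
      (l.length * 33 + 10) fun u => u = .ofList ((l.reverse ++ l₀).map e) := by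
  refine Runs.fold (I := fun pre u => u = .ofList ((pre.reverse ++ l₀).map e)) (b := 7)
    (acc := .ofList (l₀.map e)) ?_ (by simp) l
  rintro pre x _ rfl
  exact ⟨_, _, .pair (.last_triple _ _ _) (.mid_triple _ _ _), le_rfl, by simp [Val.ofList]⟩

theorem Runs.shorter (us ws : List (Val σ W P A.Carrier)) :
    Runs A nb .shorter (.pair (.ofList us) (.ofList ws)) (us.length * 21 + 20)
      fun u => u = .ofProp (us.length < ws.length) := by
  have key : ∀ us ws : List (Val σ W P A.Carrier), ∃ us' ws' : List (Val σ W P A.Carrier), ∃ τ,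
      Eval A nb (.loop (.ite (.comp .isPair .head) (.comp .isPair .tail) .nil)
        (.pair (.comp .tail .head) (.comp .tail .tail))) (.pair (.ofList us) (.ofList ws))
        (.pair (.ofList us') (.ofList ws')) τ ∧ τ ≤ us.length * 21 + 10 ∧
        (us.length < ws.length ↔ ws' ≠ []) := by
    intro us
    induction us with
    | nil =>
      intro ws
      exact ⟨[], ws, _, Eval.loop_stop (.ite_false (.comp (.head _ _) .isPair_nil) (.nil _)),
        by simp, by simp [List.length_pos_iff]⟩
    | cons u us ih =>
      intro ws
      cases ws with
      | nil =>
        exact ⟨u :: us, [], _, Eval.loop_stop (.ite_true (.comp (.head _ _) (.isPair _))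
          (Val.ofProp_ne_nil ⟨_, _, rfl⟩) (.comp (.tail _ _) .isPair_nil)), by simp, by simp⟩
      | cons w ws =>
        obtain ⟨us', ws', τ, he, hτ, hlt⟩ := ih ws
        refine ⟨us', ws', _, .loop_step (.ite_true (.comp (.head _ _) (.isPair _))
          (Val.ofProp_ne_nil ⟨_, _, rfl⟩) (.comp (.tail _ _) (.isPair _)))
          (Val.ofProp_ne_nil ⟨_, _, rfl⟩) (.pair (.comp (.head _ _) (.tail _ _))
            (.comp (.tail _ _) (.tail _ _))) he, ?_, ?_⟩
        · rw [List.length_cons, Nat.add_mul]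
          omega
        · simpa using hlt
  obtain ⟨us', ws', τ, he, hτ, hlt⟩ := key us ws
  refine ⟨_, _, .comp he (.comp (.tail _ _) (.isPair _)), by omega, ?_⟩
  have : (∃ u v, Val.ofList ws' = .pair u v) ↔ us.length < ws.length := by
    rw [hlt]
    cases ws' <;> simp [Val.ofList]
  rw [this]

end

/-! ## The learning program -/

namespace Code

/-- The list of all elements that occur in a training sequence of `k`-tuples. -/
def elements (k : ℕ) : Code σ W P :=
  .comp (fold (.comp (append k) (.pair (.comp .head last) mid))) (triple .nil .nil .id)

/-- Extend a list of elements by all their neighbours. -/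
def addNbrs : Code σ W P :=
  .comp (fold (.comp pushAll (triple .nil mid (.comp .nbrs last)))) (triple .nil .id .id)

/-- Extend a list of elements to the list of elements at distance at most `R`. -/
def ball : ℕ → Code σ W P
  | 0 => .id
  | R + 1 => .comp addNbrs (ball R)

/-- The list of all tuples of the given length with entries from a list. -/
def tuples : ℕ → Code σ W P
  | 0 => .pair .nil .nil
  | j + 1 => .comp (fold (.comp (fold (.pair (.pair last .head) mid)) (triple last mid .head)))
      (triple .id .nil (tuples j))

/-- On `(v, acc, (a, b))`, push an entry to `acc` if the answer of `m` at `(a, v)` is not `b`. -/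
def countStep (k : ℕ) (m : Code σ W P) : Code σ W P :=
  .ite (.comp m (.comp (append k) (.pair (.comp .head last) .head)))
    (.ite (.comp .tail last) mid (.pair .nil mid))
    (.ite (.comp .tail last) (.pair .nil mid) mid)

/-- On `(T, best, v)`, compare the error of the hypothesis `(φ, v)` with the best error so far. -/
def improveStep (k : ℕ) (m : Code σ W P) (φ : Formula σ W P) : Code σ W P :=
  .comp
    (.ite (.comp shorter (.pair .head (.comp .head (.comp mid .tail))))
      (.pair .head (.pair (.const (.form φ)) (.comp last .tail)))
      (.comp mid .tail))
    (.pair (.comp (fold (countStep k m)) (triple last .nil .head)) .id)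

/-- On `(T, best, list)`, improve the best hypothesis by formulas from `φs` with parameters from
the list. -/
def improve (k : ℕ) (M : Formula σ W P → Code σ W P) : List (Formula σ W P) → Code σ W P
  | [] => mid
  | φ :: φs => .comp (improve k M φs) (triple .head (fold (improveStep k (M φ) φ)) last)

/-- Search for a best hypothesis with parameters at distance at most `R` from the examples. -/
def learner (k ℓ R : ℕ) (M : Formula σ W P → Code σ W P) (φs : List (Formula σ W P)) :
    Code σ W P :=
  .comp .tail (.comp (improve k M φs)
    (triple .id (.pair (.pair .nil .id) .nil) (.comp (tuples ℓ) (.comp (ball R) (elements k)))))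

end Code

/-- The encoding of a labelled example. -/
def encodeExample {A : PreStruct σ W} {k : ℕ} (z : Example A k) : Val σ W P A.Carrier :=
  .pair (.tuple z.1) (.ofProp (z.2 = true))

theorem encodeTraining_eq {A : PreStruct σ W} {k t : ℕ} (T : Fin t → Example A k) :
    (encodeTraining T : Val σ W P A.Carrier) = .ofList ((List.ofFn T).map encodeExample) := by
  rw [encodeTraining, List.map_ofFn]
  rfl

theorem NbrOracle.length_le {A : PreStruct σ W} (nb : NbrOracle A) (a : A.Carrier) :
    (nb.list a).length ≤ A.degree := by
  classical
  have h : (A.gaifman.neighborSet a).ncard = (nb.list a).length := by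
    rw [← List.toFinset_card_of_nodup (nb.nodup a), ← Set.ncard_coe_finset]
    congr 1
    ext b
    simp [nb.mem_iff]
  rw [← h]
  exact Finset.le_sup (f := fun a : A.Carrier => (A.gaifman.neighborSet a).ncard)
    (Finset.mem_univ a)

/-- Drop the last edge of a shortest walk from the centre. Reversing the walk makes this edge the
first one, where case analysis can reach it. -/
theorem PreStruct.mem_ball_succ (A : PreStruct σ W) {R : ℕ} {X : Set A.Carrier} {b : A.Carrier} :
    b ∈ A.ball (R + 1) X ↔ b ∈ A.ball R X ∨ ∃ a ∈ A.ball R X, A.gaifman.Adj a b := by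
  constructor
  · rintro ⟨x, hx, hd⟩
    obtain ⟨p, hp⟩ := SimpleGraph.exists_walk_of_edist_ne_top
      (ne_top_of_le_ne_top (ENat.natCast_ne_top _) hd)
    rw [← hp] at hd
    have hd' : p.reverse.length ≤ R + 1 := by
      rw [SimpleGraph.Walk.length_reverse]
      exact_mod_cast hd
    revert hd'
    cases p.reverse with
    | nil => exact fun _ => Or.inl (A.subset_ball _ _ hx)
    | @cons _ c _ h q =>
      intro hd'
      refine Or.inr ⟨c, ⟨x, hx, (SimpleGraph.edist_le q.reverse).trans ?_⟩, h.symm⟩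
      rw [SimpleGraph.Walk.length_reverse]
      rw [SimpleGraph.Walk.length_cons] at hd'
      exact_mod_cast Nat.le_of_succ_le_succ hd'
  · rintro (h | ⟨a, ha, hab⟩)
    · exact A.ball_mono (Nat.le_succ R) X h
    · exact A.mem_ball_add ha (s := 1) (by
        rw [SimpleGraph.edist_eq_one_iff_adj.2 hab]
        exact le_rfl)

-- Listing the candidate parameters.

section

variable {A : PreStruct σ W} {nb : NbrOracle A}

theorem Eval.append_tuple {k m : ℕ} (a : Fin k → A.Carrier) (v : Fin m → A.Carrier) :
    Eval A nb (.append k : Code σ W P) (.pair (.tuple a) (.tuple v)) (.tuple (Fin.append a v))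
      (10 * k + 1) := by
  have := Eval.append (nb := nb) (P := P) (List.ofFn fun i => .elem (a i))
    (List.ofFn fun i => .elem (v i))
  rw [List.length_ofFn] at this
  rw [← List.ofFn_fin_append] at this
  rw [Val.tuple, Val.tuple, Val.tuple]
  convert this using 4 with i
  refine Fin.addCases (fun i => ?_) (fun i => ?_) i <;> simp

theorem Runs.elements {k : ℕ} (T : List (Example A k)) :
    Runs A nb (.elements k : Code σ W P) (.ofList (T.map encodeExample))
      (T.length * (10 * k + 37) + 16) fun u => ∃ L : List A.Carrier, u = .ofList (L.map .elem) ∧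
        L.length = k * T.length ∧ ∀ a, a ∈ L ↔ ∃ z ∈ T, ∃ i, z.1 i = a := by
  refine ((Eval.triple (.nil _) (.nil _) (.id _)).runs_comp (Runs.fold
    (I := fun T u => ∃ L : List A.Carrier, u = .ofList (L.map .elem) ∧
        L.length = k * T.length ∧ ∀ a, a ∈ L ↔ ∃ z ∈ T, ∃ i, z.1 i = a)
    (b := 10 * k + 11) ?_ ⟨[], rfl, by simp, by simp⟩ T)).mono (by ring_nf; omega) fun _ h => h
  rintro pre z _ ⟨L, rfl, hlen, hL⟩
  have he := Eval.append (nb := nb) (P := P) (List.ofFn fun i => .elem (z.1 i)) (L.map .elem)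
  rw [List.length_ofFn] at he
  refine ⟨_, _, .comp (.pair (.comp (.last_triple _ _ _) (.head _ _)) (.mid_triple _ _ _)) he,
    by omega, List.ofFn z.1 ++ L, ?_, ?_, ?_⟩
  · rw [List.map_append, List.map_ofFn]
    rfl
  · simp [hlen]
    ring
  · intro a
    simp only [List.mem_append, List.mem_ofFn, hL, List.mem_singleton]
    constructor
    · rintro (⟨i, hi⟩ | ⟨z', hz', h⟩)
      · exact ⟨z, Or.inr rfl, i, hi⟩
      · exact ⟨z', Or.inl hz', h⟩
    · rintro ⟨z', hz' | rfl, h⟩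
      · exact Or.inr ⟨z', hz', h⟩
      · exact Or.inl h

/-- Repetitions are kept, so no elements have to be compared. The price is only that the list, not
just the set, grows by a factor of at most `d + 1`. -/
theorem Runs.addNbrs {d : ℕ} (hd : A.degree ≤ d) (L : List A.Carrier) :
    Runs A nb (.addNbrs : Code σ W P) (.ofList (L.map .elem))
      (L.length * (A.word * (d + 1) + d * 33 + 48) + 16) fun u => ∃ L' : List A.Carrier,
        u = .ofList (L'.map .elem) ∧ L'.length ≤ L.length * (d + 1) ∧
          ∀ b, b ∈ L' ↔ b ∈ L ∨ ∃ a ∈ L, A.gaifman.Adj a b := by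
  refine ((Eval.triple (.nil _) (.id _) (.id _)).runs_comp (Runs.fold
    (I := fun l u => ∃ L' : List A.Carrier,
        u = .ofList (L'.map .elem) ∧ L'.length ≤ L.length + l.length * d ∧
          ∀ b, b ∈ L' ↔ b ∈ L ∨ ∃ a ∈ l, A.gaifman.Adj a b)
    (b := A.word * (d + 1) + d * 33 + 22) ?_ ⟨L, rfl, by simp, by simp⟩ L)).mono (by ring_nf; omega) ?_
  · rintro pre a _ ⟨L', rfl, hlen, hL⟩
    have hda := (nb.length_le a).trans hd
    refine ((Eval.triple (.nil _) (.mid_triple _ _ _)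
      (.comp (.last_triple _ _ _) (.nbrs a))).runs_comp (Runs.pushAll _ _ _ _)).mono ?_ ?_
    · have := Nat.mul_le_mul_left A.word (Nat.succ_le_succ hda)
      simp only [Nat.succ_eq_add_one] at this
      omega
    · rintro _ rfl
      refine ⟨_, rfl, ?_, ?_⟩
      · simp only [List.length_append, List.length_reverse, List.length_singleton, Nat.add_mul]
        omega
      · intro b
        simp only [List.mem_append, List.mem_reverse, nb.mem_iff, hL, List.mem_singleton]
        constructor
        · rintro (h | h | ⟨c, hc, h⟩)
          · exact Or.inr ⟨a, Or.inr rfl, h⟩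
          · exact Or.inl h
          · exact Or.inr ⟨c, Or.inl hc, h⟩
        · rintro (h | ⟨c, hc | rfl, h⟩)
          · exact Or.inr (Or.inl h)
          · exact Or.inr (Or.inr ⟨c, hc, h⟩)
          · exact Or.inl h
  · rintro u ⟨L', rfl, hlen, hL⟩
    exact ⟨L', rfl, by rw [Nat.mul_add]; omega, hL⟩

/-- A bound for the time of the computation of a ball of radius `R` from `m` elements. -/
def ballCost (w d m : ℕ) : ℕ → ℕ
  | 0 => 1
  | R + 1 => ballCost w d m R + m * (d + 1) ^ R * (w * (d + 1) + d * 33 + 48) + 17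

theorem Runs.ball {d : ℕ} (hd : A.degree ≤ d) (L : List A.Carrier) (R : ℕ) :
    Runs A nb (.ball R : Code σ W P) (.ofList (L.map .elem)) (ballCost A.word d L.length R)
      fun u => ∃ L' : List A.Carrier, u = .ofList (L'.map .elem) ∧
        L'.length ≤ L.length * (d + 1) ^ R ∧ ∀ b, b ∈ L' ↔ b ∈ A.ball R {a | a ∈ L} := by
  induction R with
  | zero =>
    refine ⟨_, _, .id _, le_rfl, L, rfl, by simp, fun b => ?_⟩
    simp [PreStruct.ball]
  | succ R ih =>
    refine (Runs.comp (b₂ := L.length * (d + 1) ^ R * (A.word * (d + 1) + d * 33 + 48) + 16) ih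
      ?_).mono (by rw [ballCost]; omega) fun _ h => h
    rintro _ ⟨L', rfl, hlen, hL⟩
    refine (Runs.addNbrs hd L').mono (by gcongr) ?_
    rintro _ ⟨L'', rfl, hlen', hL'⟩
    refine ⟨L'', rfl, hlen'.trans ?_, fun b => ?_⟩
    · rw [pow_succ, ← mul_assoc]
      gcongr
    · rw [hL', PreStruct.mem_ball_succ]
      simp only [hL]

/-- A bound for the time of the enumeration of the tuples from `m` elements. -/
def tuplesCost (m : ℕ) : ℕ → ℕ
  | 0 => 3
  | j + 1 => tuplesCost m j + m ^ j * (m * 37 + 46) + 20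

theorem Runs.tuples (L : List A.Carrier) (j : ℕ) :
    Runs A nb (.tuples j : Code σ W P) (.ofList (L.map .elem)) (tuplesCost L.length j)
      fun u => ∃ V : List (Fin j → A.Carrier), u = .ofList (V.map .tuple) ∧
        V.length = L.length ^ j ∧ ∀ v, v ∈ V ↔ ∀ i, v i ∈ L := by
  induction j with
  | zero =>
    refine ⟨_, _, .pair (.nil _) (.nil _), le_rfl, [Fin.elim0], ?_, by simp, fun v => ?_⟩
    · simp [Val.ofList, Val.tuple]
    · simp [Subsingleton.elim v Fin.elim0]
  | succ j ih =>
    obtain ⟨_, τ, he, hτ, V, rfl, hlen, hV⟩ := ih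
    -- The outer loop runs over the tails already listed, the inner one over first entries; the
    -- invariant describes the tuples whose tail has been processed.
    refine ((Eval.triple (.id _) (.nil _) he).runs_comp (Runs.fold
      (I := fun l u => ∃ V' : List (Fin (j + 1) → A.Carrier), u = .ofList (V'.map .tuple) ∧
        V'.length = l.length * L.length ∧ ∀ v, v ∈ V' ↔ v 0 ∈ L ∧ Fin.tail v ∈ l)
      (b := L.length * 37 + 20) ?_ ⟨[], rfl, by simp, by simp⟩ V)).mono ?_ ?_
    · rintro pre p _ ⟨V', rfl, hlen', hV'⟩
      refine ((Eval.triple (.last_triple _ _ _) (.mid_triple _ _ _)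
        (.head_triple _ _ _)).runs_comp (Runs.fold
          (I := fun l u => ∃ V'' : List (Fin (j + 1) → A.Carrier), u = .ofList (V''.map .tuple) ∧
            V''.length = V'.length + l.length ∧
              ∀ v, v ∈ V'' ↔ v ∈ V' ∨ v 0 ∈ l ∧ Fin.tail v = p)
          (b := 11) ?_ ⟨V', rfl, by simp, by simp⟩ L)).mono (by omega) ?_
      · rintro pre' b _ ⟨V'', rfl, hlen'', hV''⟩
        refine ⟨_, _, .pair (.pair (.last_triple _ _ _) (.head_triple _ _ _))
          (.mid_triple _ _ _), by omega, Fin.cons b p :: V'', ?_, ?_, ?_⟩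
        · rw [Val.ofList_map_cons, Val.tuple_cons]
        · simp [hlen'']
          omega
        · intro v
          have : v = Fin.cons b p ↔ v 0 = b ∧ Fin.tail v = p := by
            constructor
            · rintro rfl
              simp
            · rintro ⟨rfl, rfl⟩
              simp
          simp only [List.mem_cons, hV'', List.mem_append, List.not_mem_nil, or_false, this]
          tauto
      · rintro _ ⟨V'', rfl, hlen'', hV''⟩
        refine ⟨V'', rfl, ?_, fun v => ?_⟩
        · simp [hlen'', hlen', Nat.add_mul]
        · simp only [hV'', hV', List.mem_append, List.mem_singleton]
          tauto
    · rw [tuplesCost, hlen]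
      ring_nf
      omega
    · rintro _ ⟨V', rfl, hlen', hV'⟩
      refine ⟨V', rfl, by rw [hlen', hlen, pow_succ], fun v => ?_⟩
      rw [hV', hV, Fin.forall_fin_succ]
      rfl

end

/-- The number of errors of a hypothesis on a list of examples. -/
def errorCount {A : PreStruct σ W} {k ℓ : ℕ} (x : Fin k → ℕ) (y : Fin ℓ → ℕ)
    (g : Formula σ W P × (Fin ℓ → A.Carrier)) (T : List (Example A k)) : ℕ :=
  T.countP fun z => classifier A x y g.1 g.2 z.1 != z.2

/-- `best` encodes a hypothesis with the least number of errors among those in `H`, together with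
this number; if `H` is empty, the number is larger than the number of examples. -/
def IsBest {A : PreStruct σ W} {k ℓ : ℕ} (x : Fin k → ℕ) (y : Fin ℓ → ℕ) (T : List (Example A k))
    (H : Set (Formula σ W P × (Fin ℓ → A.Carrier))) (best : Val σ W P A.Carrier) : Prop :=
  ∃ cs h, best = .pair (.ofList cs) h ∧ (∀ g ∈ H, cs.length ≤ errorCount x y g T) ∧
    (cs.length ≤ T.length → ∃ g ∈ H, h = encodeHypothesis g ∧ cs.length = errorCount x y g T)

-- Searching for the hypothesis with the fewest errors.

section

variable {A : PreStruct σ W} {nb : NbrOracle A} {k ℓ : ℕ} {x : Fin k → ℕ} {y : Fin ℓ → ℕ}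

/-- Programs have no natural numbers, so errors are counted in unary, by the length of a list. The
four cases of answer and label match the branches of `Code.countStep`. -/
theorem Runs.countErrors {m : Code σ W P} {φ : Formula σ W P} {v : Fin ℓ → A.Carrier} {F : ℕ}
    (hm : ∀ a : Fin k → A.Carrier, ∃ τ ≤ F,
      Eval A nb m (.tuple (Fin.append a v)) (.ofProp (φ.Sat A (assign x y a v))) τ)
    (T : List (Example A k)) :
    Runs A nb (.fold (.countStep k m)) (.triple (.tuple v) .nil (.ofList (T.map encodeExample)))
      (T.length * (F + 10 * k + 48) + 10)
      fun u => ∃ cs, u = .ofList cs ∧ cs.length = errorCount x y (φ, v) T := by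
  refine (Runs.fold (I := fun T u => ∃ cs, u = .ofList cs ∧
    cs.length = errorCount x y (φ, v) T) (b := F + 10 * k + 22) ?_
    ⟨[], rfl, rfl⟩ T).mono (by ring_nf; omega) fun _ h => h
  rintro pre ⟨a, lab⟩ _ ⟨cs, rfl, hcs⟩
  obtain ⟨τ, hτ, he⟩ := hm a
  have hcond := Eval.comp (.comp (.pair (.comp (.last_triple (.tuple v) (.ofList cs)
    (encodeExample (a, lab))) (.head _ _)) (.head_triple _ _ _)) (Eval.append_tuple a v)) he
  have hcount : errorCount x y (φ, v) (pre ++ [(a, lab)]) = errorCount x y (φ, v) pre +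
      if classifier A x y φ v a != lab then 1 else 0 := by
    simp [errorCount, List.countP_append, List.countP_singleton]
  have hacc : Eval A nb (.mid : Code σ W P) (.triple (.tuple v) (.ofList cs)
    (encodeExample (a, lab))) (.ofList cs) 3 := .mid_triple _ _ _
  have hpush : Eval A nb (.pair .nil .mid : Code σ W P) (.triple (.tuple v) (.ofList cs)
    (encodeExample (a, lab))) (.ofList (.nil :: cs)) 5 := .pair (.nil _) (.mid_triple _ _ _)
  have hlab : Eval A nb (.comp .tail .last : Code σ W P) (.triple (.tuple v) (.ofList cs)
    (encodeExample (a, lab))) (.ofProp (lab = true)) 5 := .comp (.last_triple _ _ _) (.tail _ _)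
  by_cases hsat : φ.Sat A (assign x y a v)
  · cases lab with
    | true =>
      refine ⟨_, _, .ite_true hcond (Val.ofProp_ne_nil hsat) (.ite_true hlab
        (Val.ofProp_ne_nil rfl) hacc), by omega, cs, rfl, ?_⟩
      simp [hcount, hcs, classifier, hsat]
    | false =>
      rw [Val.ofProp_eq_nil (by simp)] at hlab
      refine ⟨_, _, .ite_true hcond (Val.ofProp_ne_nil hsat) (.ite_false hlab hpush),
        by omega, _, rfl, ?_⟩
      simp [hcount, hcs, classifier, hsat]
  · rw [Val.ofProp_eq_nil hsat] at hcond
    cases lab with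
    | true =>
      refine ⟨_, _, .ite_false hcond (.ite_true hlab (Val.ofProp_ne_nil rfl) hpush),
        by omega, _, rfl, ?_⟩
      simp [hcount, hcs, classifier, hsat]
    | false =>
      rw [Val.ofProp_eq_nil (by simp)] at hlab
      refine ⟨_, _, .ite_false hcond (.ite_false hlab hacc), by omega, cs, rfl, ?_⟩
      simp [hcount, hcs, classifier, hsat]

theorem Runs.improveStep {m : Code σ W P} {φ : Formula σ W P} {v : Fin ℓ → A.Carrier} {F : ℕ}
    (hm : ∀ a : Fin k → A.Carrier, ∃ τ ≤ F,
      Eval A nb m (.tuple (Fin.append a v)) (.ofProp (φ.Sat A (assign x y a v))) τ)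
    (T : List (Example A k)) {H : Set (Formula σ W P × (Fin ℓ → A.Carrier))}
    {best : Val σ W P A.Carrier} (hbest : IsBest x y T H best) :
    Runs A nb (.improveStep k m φ) (.triple (.ofList (T.map encodeExample)) best (.tuple v))
      (T.length * (F + 10 * k + 69) + 61) (IsBest x y T (insert (φ, v) H)) := by
  obtain ⟨cs, h, rfl, hmin, hatt⟩ := hbest
  obtain ⟨_, τ, hcount, hτ, ds, rfl, hds⟩ := (Eval.triple (.last_triple _ _ _) (.nil _)
    (.head_triple (.ofList (T.map encodeExample)) (.pair (.ofList cs) h) (.tuple v))).runs_comp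
    (Runs.countErrors hm T)
  -- This keeps the unary comparison linear in the number of examples.
  have hle : ds.length ≤ T.length := hds ▸ List.countP_le_length
  obtain ⟨_, τ', hshort, hτ', rfl⟩ := Runs.shorter (nb := nb) ds cs
  have hcond := Eval.comp (.pair (.head (.ofList ds) (.triple (.ofList (T.map encodeExample))
    (.pair (.ofList cs) h) (.tuple v))) (.comp (.comp (.tail _ _) (.mid_triple _ _ _))
      (.head _ _))) hshort
  by_cases hlt : ds.length < cs.length
  · refine ⟨_, _, .comp (.pair hcount (.id _)) (.ite_true hcond (Val.ofProp_ne_nil hlt)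
      (.pair (.head _ _) (.pair (.const _ _) (.comp (.tail _ _) (.last_triple _ _ _))))), ?_,
      ds, _, rfl, ?_, fun _ => ⟨_, Set.mem_insert _ _, rfl, hds⟩⟩
    · ring_nf at hτ ⊢
      omega
    · rintro g (rfl | hg)
      · exact hds.le
      · exact hlt.le.trans (hmin g hg)
  · rw [Val.ofProp_eq_nil hlt] at hcond
    refine ⟨_, _, .comp (.pair hcount (.id _)) (.ite_false hcond
      (.comp (.tail _ _) (.mid_triple _ _ _))), ?_, cs, h, rfl, ?_, fun h' => ?_⟩
    · ring_nf at hτ ⊢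
      omega
    · rintro g (rfl | hg)
      · exact (not_lt.1 hlt).trans hds.le
      · exact hmin g hg
    · obtain ⟨g, hg, h⟩ := hatt h'
      exact ⟨g, Set.mem_insert_of_mem _ hg, h⟩

theorem Runs.improve {M : Formula σ W P → Code σ W P} {F : ℕ} (T : List (Example A k))
    (V : List (Fin ℓ → A.Carrier)) (φs : List (Formula σ W P))
    (hM : ∀ φ ∈ φs, ∀ (a : Fin k → A.Carrier) (v : Fin ℓ → A.Carrier), ∃ τ ≤ F,
      Eval A nb (M φ) (.tuple (Fin.append a v)) (.ofProp (φ.Sat A (assign x y a v))) τ)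
    {H : Set (Formula σ W P × (Fin ℓ → A.Carrier))} {best : Val σ W P A.Carrier}
    (hbest : IsBest x y T H best) :
    Runs A nb (.improve k M φs) (.triple (.ofList (T.map encodeExample)) best
        (.ofList (V.map .tuple)))
      (φs.length * (V.length * (T.length * (F + 10 * k + 69) + 87) + 17) + 3)
      (IsBest x y T (H ∪ {g | g.1 ∈ φs ∧ g.2 ∈ V})) := by
  induction φs generalizing H best with
  | nil => exact ⟨_, _, .mid_triple _ _ _, by simp, by simpa using hbest⟩
  | cons φ φs ih =>
    obtain ⟨best', τ, he, hτ, hbest'⟩ := Runs.fold (nb := nb)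
      (ctx := .ofList (T.map encodeExample)) (step := .improveStep k (M φ) φ)
      (e := Val.tuple) (I := fun l => IsBest x y T (H ∪ {g | g.1 = φ ∧ g.2 ∈ l}))
      (b := T.length * (F + 10 * k + 69) + 61) (by
        intro pre v acc hacc
        refine (Runs.improveStep (hM φ (by simp) · v) T hacc).mono le_rfl fun u hu => ?_
        convert hu using 1
        ext ⟨φ', v'⟩
        simp only [List.mem_append, List.mem_singleton, Set.mem_union, Set.mem_ofPred_eq,
          Set.mem_insert_iff, Prod.mk.injEq]
        tauto) (acc := best) (by simpa using hbest) V
    refine ((Eval.triple (.head_triple _ _ _) he (.last_triple _ _ _)).runs_comp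
      (ih (fun φ hφ => hM φ (List.mem_cons_of_mem _ hφ)) hbest')).mono ?_ fun u hu => ?_
    · replace hτ : τ ≤ V.length * (T.length * (F + 10 * k + 69) + 87) + 10 := hτ
      rw [List.length_cons, Nat.add_mul]
      omega
    · convert hu using 1
      ext ⟨φ', v'⟩
      simp only [List.mem_cons, Set.mem_union, Set.mem_ofPred_eq]
      tauto

theorem tuplesCost_mono {m m' : ℕ} (h : m ≤ m') (j : ℕ) : tuplesCost m j ≤ tuplesCost m' j := by
  induction j with
  | zero => exact le_rfl
  | succ j ih =>
    rw [tuplesCost, tuplesCost]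
    gcongr

/-- A bound for the time of the learning program on `n` examples. -/
def learnerCost (k ℓ R p w d n F : ℕ) : ℕ :=
  n * (10 * k + 37) + ballCost w d (k * n) R + tuplesCost (k * n * (d + 1) ^ R) ℓ +
    p * ((k * n * (d + 1) ^ R) ^ ℓ * (n * (F + 10 * k + 69) + 87) + 17) + 40

theorem Runs.learner {M : Formula σ W P → Code σ W P} {F d : ℕ} (hd : A.degree ≤ d)
    (T : List (Example A k)) {φs : List (Formula σ W P)} (hφs : φs ≠ []) (R : ℕ)
    (hM : ∀ φ ∈ φs, ∀ (a : Fin k → A.Carrier) (v : Fin ℓ → A.Carrier), ∃ τ ≤ F,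
      Eval A nb (M φ) (.tuple (Fin.append a v)) (.ofProp (φ.Sat A (assign x y a v))) τ)
    {X : Set A.Carrier} (hX : X = {a | ∃ z ∈ T, ∃ i, z.1 i = a}) (hne : X.Nonempty ∨ ℓ = 0) :
    Runs A nb (.learner k ℓ R M φs) (.ofList (T.map encodeExample))
      (learnerCost k ℓ R φs.length A.word d T.length F)
      fun u => ∃ g : Formula σ W P × (Fin ℓ → A.Carrier), u = encodeHypothesis g ∧
        g.1 ∈ φs ∧ (∀ j, g.2 j ∈ A.ball R X) ∧ ∀ g' : Formula σ W P × (Fin ℓ → A.Carrier),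
          g'.1 ∈ φs → (∀ j, g'.2 j ∈ A.ball R X) → errorCount x y g T ≤ errorCount x y g' T := by
  obtain ⟨_, τ₁, he₁, hτ₁, L, rfl, hLlen, hL⟩ := Runs.elements (nb := nb) (P := P) T
  obtain ⟨_, τ₂, he₂, hτ₂, L', rfl, hL'len, hL'⟩ := Runs.ball (nb := nb) (P := P) hd L R
  obtain ⟨_, τ₃, he₃, hτ₃, V, rfl, hVlen, hV⟩ := Runs.tuples (nb := nb) (P := P) L' ℓ
  have hLX : {a | a ∈ L} = X := by
    rw [hX]
    exact Set.ext hL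
  rw [hLX] at hL'
  -- The initial count is a list one longer than `T`. No hypothesis makes that many errors, so the
  -- first candidate replaces it.
  have hinit : IsBest x y T (∅ : Set (Formula σ W P × (Fin ℓ → A.Carrier)))
      (.pair (.pair .nil (.ofList (T.map encodeExample))) .nil) := by
    refine ⟨.nil :: T.map encodeExample, _, rfl, by simp, fun h => ?_⟩
    simp at h
  obtain ⟨_, τ₄, he₄, hτ₄, cs, h, rfl, hmin, hatt⟩ := Runs.improve T V φs hM hinit
  have hV' : ∀ v, v ∈ V ↔ ∀ j, v j ∈ A.ball R X := fun v => by simp only [hV, hL']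
  have hVne : ∃ v, v ∈ V := by
    rcases hne with ⟨a, ha⟩ | rfl
    · exact ⟨fun _ => a, (hV' _).2 fun _ => A.subset_ball _ _ ha⟩
    · exact ⟨Fin.elim0, (hV' _).2 fun j => j.elim0⟩
  obtain ⟨v₀, hv₀⟩ := hVne
  obtain ⟨φ₀, hφ₀⟩ := List.exists_mem_of_ne_nil _ hφs
  -- Since at least one candidate was tried, the final count is at most the number of examples,
  -- hence it belongs to an actual hypothesis.
  obtain ⟨g, hg, rfl, hcs⟩ := hatt ((hmin (φ₀, v₀) (Or.inr ⟨hφ₀, hv₀⟩)).trans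
    List.countP_le_length)
  have hg' : g.1 ∈ φs ∧ g.2 ∈ V := by simpa using hg
  refine ⟨_, _, .comp (.comp (.triple (.id _) (.pair (.pair (.nil _) (.id _)) (.nil _))
    (.comp (.comp he₁ he₂) he₃)) he₄) (.tail _ _), ?_, g, rfl, hg'.1, (hV' _).1 hg'.2,
    fun g' h1 h2 => hcs ▸ hmin g' (Or.inr ⟨h1, (hV' _).2 h2⟩)⟩
  rw [hLlen] at hτ₂ hL'len
  have h3 := hτ₃.trans (tuplesCost_mono hL'len ℓ)
  have h4 : V.length ≤ (k * T.length * (d + 1) ^ R) ^ ℓ := hVlen ▸ Nat.pow_le_pow_left hL'len ℓ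
  have h5 : φs.length * (V.length * (T.length * (F + 10 * k + 69) + 87) + 17) ≤
      φs.length * ((k * T.length * (d + 1) ^ R) ^ ℓ * (T.length * (F + 10 * k + 69) + 87) + 17) := by
    gcongr
  rw [learnerCost]
  omega

end

/-! ## Polynomial bounds -/

/-- Functions bounded by a polynomial. -/
def PolyBounded (p : ℕ → ℕ) : Prop := ∃ K m : ℕ, ∀ X, 1 ≤ X → p X ≤ K * X ^ m

theorem PolyBounded.const (c : ℕ) : PolyBounded fun _ => c := ⟨c, 0, by simp⟩

theorem PolyBounded.id : PolyBounded fun X => X := ⟨1, 1, by simp⟩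

theorem PolyBounded.add {p q : ℕ → ℕ} (hp : PolyBounded p) (hq : PolyBounded q) :
    PolyBounded fun X => p X + q X := by
  obtain ⟨K, m, h⟩ := hp
  obtain ⟨K', m', h'⟩ := hq
  refine ⟨K + K', max m m', fun X hX => ?_⟩
  rw [Nat.add_mul]
  exact Nat.add_le_add ((h X hX).trans (by gcongr; exact le_max_left _ _))
    ((h' X hX).trans (by gcongr; exact le_max_right _ _))

theorem PolyBounded.mul {p q : ℕ → ℕ} (hp : PolyBounded p) (hq : PolyBounded q) :
    PolyBounded fun X => p X * q X := by
  obtain ⟨K, m, h⟩ := hp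
  obtain ⟨K', m', h'⟩ := hq
  refine ⟨K * K', m + m', fun X hX => (Nat.mul_le_mul (h X hX) (h' X hX)).trans ?_⟩
  rw [pow_add]
  exact le_of_eq (by ring)

theorem PolyBounded.pow {p : ℕ → ℕ} (hp : PolyBounded p) (j : ℕ) :
    PolyBounded fun X => p X ^ j := by
  induction j with
  | zero => simpa using PolyBounded.const 1
  | succ j ih => simpa only [pow_succ] using ih.mul hp

theorem PolyBounded.ballCost {p : ℕ → ℕ} (hp : PolyBounded p) (R : ℕ) :
    PolyBounded fun X => ballCost X X (p X) R := by
  induction R with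
  | zero => exact .const 1
  | succ R ih =>
    exact (ih.add ((hp.mul ((PolyBounded.id.add (.const 1)).pow R)).mul
      (((PolyBounded.id.mul (.add .id (.const 1))).add (.mul .id (.const 33))).add
        (.const 48)))).add (.const 17)

theorem PolyBounded.tuplesCost {p : ℕ → ℕ} (hp : PolyBounded p) (j : ℕ) :
    PolyBounded fun X => tuplesCost (p X) j := by
  induction j with
  | zero => exact .const 3
  | succ j ih =>
    exact (ih.add ((hp.pow j).mul ((hp.mul (.const 37)).add (.const 46)))).add (.const 20)

theorem ballCost_mono {w d m w' d' m' : ℕ} (hw : w ≤ w') (hd : d ≤ d') (hm : m ≤ m') (R : ℕ) :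
    ballCost w d m R ≤ ballCost w' d' m' R := by
  induction R with
  | zero => exact le_rfl
  | succ R ih =>
    rw [ballCost, ballCost]
    gcongr

/-- The model checking time `F` must appear linearly, so it is kept out of the polynomial; terms
without `F` are multiplied by it, using `1 ≤ F`. All other quantities are bounded by the single
variable `X`. -/
theorem learnerCost_polyBounded (k ℓ R p : ℕ) : ∃ q : ℕ → ℕ, PolyBounded q ∧
    ∀ X w d n F, w ≤ X → d ≤ X → n ≤ X → 1 ≤ F → learnerCost k ℓ R p w d n F ≤ F * q X := by
  have hm : PolyBounded fun X => k * X * (X + 1) ^ R :=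
    (PolyBounded.mul (.const k) .id).mul ((PolyBounded.id.add (.const 1)).pow R)
  refine ⟨fun X => X * (10 * k + 37) + ballCost X X (k * X) R +
    tuplesCost (k * X * (X + 1) ^ R) ℓ + p * ((k * X * (X + 1) ^ R) ^ ℓ *
      (X * (1 + 10 * k + 69) + 87) + 17) + 40, ?_, ?_⟩
  · exact ((((PolyBounded.mul .id (.const (10 * k + 37))).add
      (PolyBounded.ballCost (.mul (.const k) .id) R)).add (hm.tuplesCost ℓ)).add
      (.mul (.const p) (.add (.mul (hm.pow ℓ) (.add (.mul .id (.const (1 + 10 * k + 69)))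
        (.const 87))) (.const 17)))).add (.const 40)
  · intro X w d n F hw hd hn hF
    have h1 : n * (10 * k + 37) ≤ F * (X * (10 * k + 37)) :=
      (Nat.mul_le_mul_right _ hn).trans (Nat.le_mul_of_pos_left _ hF)
    have h2 : ballCost w d (k * n) R ≤ F * ballCost X X (k * X) R :=
      (ballCost_mono hw hd (Nat.mul_le_mul_left k hn) R).trans (Nat.le_mul_of_pos_left _ hF)
    have h0 : k * n * (d + 1) ^ R ≤ k * X * (X + 1) ^ R := by gcongr
    have h3 : tuplesCost (k * n * (d + 1) ^ R) ℓ ≤ F * tuplesCost (k * X * (X + 1) ^ R) ℓ :=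
      (tuplesCost_mono h0 ℓ).trans (Nat.le_mul_of_pos_left _ hF)
    have h5 : n * (F + 10 * k + 69) + 87 ≤ F * (X * (1 + 10 * k + 69) + 87) := by
      have e1 : F + 10 * k + 69 ≤ F * (1 + 10 * k + 69) := by nlinarith [Nat.zero_le k]
      have e2 := Nat.mul_le_mul hn e1
      nlinarith
    have h4 : p * ((k * n * (d + 1) ^ R) ^ ℓ * (n * (F + 10 * k + 69) + 87) + 17) ≤
        F * (p * ((k * X * (X + 1) ^ R) ^ ℓ * (X * (1 + 10 * k + 69) + 87) + 17)) := by
      have e1 := Nat.mul_le_mul (Nat.pow_le_pow_left h0 ℓ) h5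
      have e2 : (k * n * (d + 1) ^ R) ^ ℓ * (n * (F + 10 * k + 69) + 87) + 17 ≤
          F * ((k * X * (X + 1) ^ R) ^ ℓ * (X * (1 + 10 * k + 69) + 87) + 17) := by
        rw [Nat.mul_add F]
        refine Nat.add_le_add (e1.trans (le_of_eq (by ring))) (by omega)
      exact (Nat.mul_le_mul_left p e2).trans (le_of_eq (by ring))
    rw [learnerCost]
    simp only [Nat.mul_add F]
    omega

/-! ## Empirical risk minimisation over finite classes -/

/-- Hoeffding's inequality for the comparison of the empirical frequencies of two events. -/
theorem measureReal_count_le_count {Z : Type} [MeasurableSpace Z] [Finite Z]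
    [DiscreteMeasurableSpace Z] (D : Measure Z) [IsProbabilityMeasure D] (t : ℕ) {ε : ℝ}
    (hε : 0 ≤ ε) {E E₀ : Set Z} (h : D.real E₀ + ε ≤ D.real E) :
    (Measure.pi fun _ : Fin t => D).real
      {T | ({i | T i ∈ E} : Set (Fin t)).ncard ≤ ({i | T i ∈ E₀} : Set (Fin t)).ncard} ≤
      Real.exp (-(t * ε ^ 2 / 2)) := by
  classical
  rcases Nat.eq_zero_or_pos t with rfl | ht
  · simp
  -- `f` has values in `[-1, 1]` and mean at most `-ε`. If `E` is hit no more often than `E₀`, then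
  -- the sum of `f` is nonnegative, so the centred sum is at least `t * ε`.
  let f : Z → ℝ := fun z => E₀.indicator 1 z - E.indicator 1 z
  have hfm : Measurable f := measurable_of_finite f
  have hfint : ∫ z, f z ∂D = D.real E₀ - D.real E := by
    simp only [f]
    rw [integral_sub (Integrable.of_finite) (Integrable.of_finite),
      integral_indicator_one (MeasurableSet.of_discrete),
      integral_indicator_one (MeasurableSet.of_discrete)]
  have hfI : ∀ z, f z ∈ Set.Icc (-1 : ℝ) 1 := by
    intro z
    simp only [f, Set.indicator_apply, Pi.one_apply, Set.mem_Icc]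
    split_ifs <;> norm_num
  have hsub : ∀ i : Fin t, ProbabilityTheory.HasSubgaussianMGF
      (fun T : Fin t → Z => f (T i) - ∫ z, f z ∂D) 1 (Measure.pi fun _ : Fin t => D) := by
    intro i
    have h1 := ProbabilityTheory.hasSubgaussianMGF_of_mem_Icc (μ := Measure.pi fun _ : Fin t => D)
      (X := fun T => f (T i)) (a := -1) (b := 1) (measurable_of_finite _).aemeasurable
      (ae_of_all _ fun T => hfI (T i))
    have h2 : ∫ T, f (T i) ∂(Measure.pi fun _ : Fin t => D) = ∫ z, f z ∂D :=
      integral_comp_eval (μ := fun _ : Fin t => D) (i := i) (f := f) hfm.aestronglyMeasurable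
    rw [h2] at h1
    -- The variance proxy of a variable on an interval is the square of half its length, here 1.
    convert h1 using 1
    ext
    norm_num
  have hind : ProbabilityTheory.iIndepFun (fun (i : Fin t) (T : Fin t → Z) => f (T i) - ∫ z, f z ∂D)
      (Measure.pi fun _ : Fin t => D) :=
    ProbabilityTheory.iIndepFun_pi (μ := fun _ : Fin t => D)
      (X := fun _ z => f z - ∫ z, f z ∂D) fun _ => (measurable_of_finite _).aemeasurable
  have key := ProbabilityTheory.HasSubgaussianMGF.measure_sum_ge_le_of_iIndepFun hind
    (c := fun _ => 1) (s := Finset.univ) (fun i _ => hsub i) (ε := t * ε) (by positivity)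
  have hexp : Real.exp (-(t * ε) ^ 2 / (2 * ↑(∑ i ∈ (Finset.univ : Finset (Fin t)), (1 : NNReal)))) =
      Real.exp (-(t * ε ^ 2 / 2)) := by
    congr 1
    have : (t : ℝ) ≠ 0 := by positivity
    simp
    field_simp
  rw [hexp] at key
  refine (measureReal_mono ?_).trans key
  intro T hT
  have hcount : ∀ B : Set Z, (({i | T i ∈ B} : Set (Fin t)).ncard : ℝ) =
      ∑ i, B.indicator (1 : Z → ℝ) (T i) := by
    intro B
    rw [Set.ncard_eq_toFinset_card']
    simp [Set.indicator_apply]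
  have hT' : (({i | T i ∈ E} : Set (Fin t)).ncard : ℝ) ≤ ({i | T i ∈ E₀} : Set (Fin t)).ncard := by
    exact_mod_cast hT
  rw [hcount, hcount] at hT'
  have hsum : ∑ i, f (T i) = ∑ i, E₀.indicator (1 : Z → ℝ) (T i) -
      ∑ i, E.indicator (1 : Z → ℝ) (T i) := Finset.sum_sub_distrib _ _
  change t * ε ≤ ∑ i, (f (T i) - ∫ z, f z ∂D)
  rw [Finset.sum_sub_distrib, hsum, hfint]
  simp only [Finset.sum_const, Finset.card_univ, Fintype.card_fin, nsmul_eq_mul]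
  have := mul_le_mul_of_nonneg_left h (Nat.cast_nonneg (α := ℝ) t)
  linarith

-- Union bound and sample size.

section

variable {A : PreStruct σ W} {k : ℕ}

/-- The probability of failure of empirical risk minimisation over a finite class. -/
theorem one_sub_le_of_empirical_minimiser (D : Measure (Example A k)) [IsProbabilityMeasure D]
    {H : Set ((Fin k → A.Carrier) → Bool)} (hH : H.Nonempty) {t : ℕ} (ht : 0 < t) {ε : ℝ}
    (hε : 0 ≤ ε) (learn : (Fin t → Example A k) → (Fin k → A.Carrier) → Bool)
    (hlearn : ∀ T, learn T ∈ H ∧ ∀ h ∈ H, trainError T (learn T) ≤ trainError T h) :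
    1 - ((H.ncard : ℝ) - 1) * Real.exp (-(t * ε ^ 2 / 2)) ≤
      (Measure.pi fun _ : Fin t => D).real
        {T | genError D (learn T) ≤ sInf (genError D '' H) + ε} := by
  classical
  have hfin : H.Finite := Set.toFinite H
  obtain ⟨h₀, hh₀, hmin⟩ := Set.exists_min_image H (genError D) hfin hH
  have hInf : genError D h₀ ≤ sInf (genError D '' H) :=
    le_csInf (hH.image _) (by rintro _ ⟨h, hh, rfl⟩; exact hmin h hh)
  set μ := Measure.pi fun _ : Fin t => D
  set G : Set (Fin t → Example A k) :=
    {T | genError D (learn T) ≤ sInf (genError D '' H) + ε}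
  let E : ((Fin k → A.Carrier) → Bool) → Set (Example A k) := fun h => {z | h z.1 ≠ z.2}
  let Bad : ((Fin k → A.Carrier) → Bool) → Set (Fin t → Example A k) := fun h =>
    {T | ({i | T i ∈ E h} : Set (Fin t)).ncard ≤ ({i | T i ∈ E h₀} : Set (Fin t)).ncard}
  -- A failing sample returns a hypothesis more than `ε` worse than `h₀`, hence not `h₀` itself.
  -- Removing `h₀` gives the `- 1` in the bound, which later absorbs the `+ 1` of
  -- `ncard_conceptClass_le`.
  let B : Finset ((Fin k → A.Carrier) → Bool) :=
    (hfin.toFinset.erase h₀).filter fun h => genError D h₀ + ε ≤ genError D h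
  have hsub : Gᶜ ⊆ ⋃ h ∈ B, Bad h := by
    intro T hT
    obtain ⟨hLH, hLmin⟩ := hlearn T
    have hgt : sInf (genError D '' H) + ε < genError D (learn T) := not_le.1 hT
    simp only [Set.mem_iUnion]
    refine ⟨learn T, ?_, ?_⟩
    · simp only [B, Finset.mem_filter, Finset.mem_erase, Set.Finite.mem_toFinset]
      refine ⟨⟨fun h => ?_, hLH⟩, by linarith⟩
      rw [h] at hgt
      linarith
    · have := hLmin h₀ hh₀
      rw [trainError, trainError, div_le_div_iff_of_pos_right (by positivity)] at this
      exact_mod_cast this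
  have hcard : (B.card : ℝ) ≤ (H.ncard : ℝ) - 1 := by
    have h1 : B.card ≤ (hfin.toFinset.erase h₀).card := Finset.card_filter_le _ _
    rw [Finset.card_erase_of_mem (by simpa using hh₀), ← Set.ncard_eq_toFinset_card] at h1
    have h2 : 0 < H.ncard := (Set.ncard_pos hfin).2 hH
    have h3 : B.card + 1 ≤ H.ncard := by omega
    have : ((B.card + 1 : ℕ) : ℝ) ≤ H.ncard := by exact_mod_cast h3
    push_cast at this
    linarith
  have hbad : μ.real Gᶜ ≤ B.card * Real.exp (-(t * ε ^ 2 / 2)) := by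
    calc μ.real Gᶜ ≤ μ.real (⋃ h ∈ B, Bad h) := measureReal_mono hsub (measure_ne_top _ _)
      _ ≤ ∑ h ∈ B, μ.real (Bad h) := measureReal_biUnion_finset_le _ _
      _ ≤ ∑ _h ∈ B, Real.exp (-(t * ε ^ 2 / 2)) := Finset.sum_le_sum fun h hh =>
          measureReal_count_le_count D t hε (Finset.mem_filter.1 hh).2
      _ = B.card * Real.exp (-(t * ε ^ 2 / 2)) := by simp
  have hG : μ.real Gᶜ = 1 - μ.real G := probReal_compl_eq_one_sub MeasurableSet.of_discrete
  have := mul_le_mul_of_nonneg_right hcard (Real.exp_pos (-(t * ε ^ 2 / 2))).le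
  linarith

/-- For at least two elements the factor `|Φ|` is absorbed into a power of the size. For one element
this power is 1 while both constant classifiers may occur, hence the extra `+ 1`. -/
theorem ncard_conceptClass_le {ℓ : ℕ} {Φ : Set (Formula σ W P)} (hfin : Φ.Finite)
    (A : PreStruct σ W) (x : Fin k → ℕ) (y : Fin ℓ → ℕ) :
    (conceptClass Φ A x y).ncard ≤ A.size ^ (ℓ + Φ.ncard) + 1 := by
  classical
  rcases Nat.lt_or_ge 1 A.size with h1 | h1
  · have himage : conceptClass Φ A x y =
        (fun g : Formula σ W P × (Fin ℓ → A.Carrier) => classifier A x y g.1 g.2) ''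
          (Φ ×ˢ Set.univ) := by
      ext h
      constructor
      · rintro ⟨φ, hφ, v, rfl⟩
        exact ⟨(φ, v), ⟨hφ, trivial⟩, rfl⟩
      · rintro ⟨⟨φ, v⟩, ⟨hφ, -⟩, rfl⟩
        exact ⟨φ, hφ, v, rfl⟩
    have h2 : Φ.ncard ≤ A.size ^ Φ.ncard := (Nat.lt_pow_self h1).le
    calc (conceptClass Φ A x y).ncard ≤ (Φ ×ˢ (Set.univ : Set (Fin ℓ → A.Carrier))).ncard := by
          rw [himage]
          exact Set.ncard_image_le (hfin.prod Set.finite_univ)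
      _ = Φ.ncard * A.size ^ ℓ := by
          rw [Set.ncard_prod, Set.ncard_univ, Nat.card_eq_fintype_card, Fintype.card_fun,
            Fintype.card_fin, PreStruct.size]
      _ ≤ A.size ^ Φ.ncard * A.size ^ ℓ := Nat.mul_le_mul_right _ h2
      _ = A.size ^ (ℓ + Φ.ncard) := by rw [← pow_add, add_comm]
      _ ≤ _ := Nat.le_succ _
  · have h2 : A.size = 1 := le_antisymm h1 Fintype.card_pos
    rw [h2, one_pow]
    refine (Set.ncard_le_card _).trans ?_
    rw [Nat.card_eq_fintype_card, Fintype.card_fun, Fintype.card_fun, Fintype.card_fin,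
      show Fintype.card A.Carrier = 1 from h2]
    simp

/-- Some example is needed: for `k > 0` it supplies an element around which to place parameters, and
training errors are divided by the number of examples. -/
theorem sampleSize_pos {s n : ℕ} (hs : 0 < s) (hn : 0 < n) {ε δ : ℝ} (hε : 0 < ε) (hδ : 0 < δ)
    (hδ1 : δ < 1) : 0 < sampleSize s n ε δ := by
  have h1 : (1 : ℝ) < n / δ := by
    rw [lt_div_iff₀ hδ]
    have : (1 : ℝ) ≤ n := by exact_mod_cast hn
    linarith
  have := Real.log_pos h1
  exact Nat.mul_pos hs (Nat.ceil_pos.2 (by positivity))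

/-- The factor 2 in the sample size cancels the 2 in Hoeffding's exponent, so the exponential is at
most `(δ / n) ^ q`. What remains is `δ ^ q`, which is at most `δ` since `q` is positive. -/
theorem exp_sampleSize_le {q n : ℕ} (hq : 0 < q) (hn : 0 < n) {ε δ : ℝ} (hε : 0 < ε) (hδ : 0 < δ)
    (hδ1 : δ < 1) :
    (n : ℝ) ^ q * Real.exp (-((sampleSize (2 * q) n ε δ : ℕ) * ε ^ 2 / 2)) ≤ δ := by
  have hn' : (0 : ℝ) < n := by exact_mod_cast hn
  have h1 : q * Real.log (n / δ) ≤ (sampleSize (2 * q) n ε δ : ℕ) * ε ^ 2 / 2 := by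
    have h2 := Nat.le_ceil (Real.log (n / δ) / ε ^ 2)
    rw [div_le_iff₀ (by positivity)] at h2
    rw [sampleSize]
    push_cast
    have := mul_le_mul_of_nonneg_left h2 (Nat.cast_nonneg (α := ℝ) q)
    linarith
  have h2 : Real.exp (-(q * Real.log (n / δ))) = (δ / n) ^ q := by
    rw [← mul_neg, ← Real.log_inv, inv_div, Real.exp_nat_mul, Real.exp_log (by positivity)]
  calc (n : ℝ) ^ q * Real.exp (-((sampleSize (2 * q) n ε δ : ℕ) * ε ^ 2 / 2))
      ≤ (n : ℝ) ^ q * (δ / n) ^ q := by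
        rw [← h2]
        gcongr
    _ = δ ^ q := by
        rw [← mul_pow]
        congr 1
        field_simp
    _ ≤ δ := pow_le_of_le_one hδ.le hδ1.le hq.ne'

/-- Empirical risk minimisation is an agnostic PAC learner. -/
theorem isAgnosticPACLearner_of_empirical_minimiser {ℓ : ℕ} {Φ : Set (Formula σ W P)}
    (hfin : Φ.Finite) (hne : Φ.Nonempty) {x : Fin k → ℕ} {y : Fin ℓ → ℕ}
    (learn : ∀ t : ℕ, (Fin t → Example A k) → (Fin k → A.Carrier) → Bool)
    (hlearn : ∀ t (T : Fin t → Example A k), 0 < t → learn t T ∈ conceptClass Φ A x y ∧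
      ∀ h ∈ conceptClass Φ A x y, trainError T (learn t T) ≤ trainError T h) :
    IsAgnosticPACLearner (conceptClass Φ A x y) (sampleSize (2 * (ℓ + Φ.ncard)) A.size) learn := by
  rintro ε ⟨hε, -⟩ δ ⟨hδ, hδ1⟩ D hD
  have hp : 0 < Φ.ncard := (Set.ncard_pos hfin).2 hne
  have hn : 0 < A.size := Fintype.card_pos
  have ht := sampleSize_pos (s := 2 * (ℓ + Φ.ncard)) (by omega) hn hε hδ hδ1
  have hH : (conceptClass Φ A x y).Nonempty := by
    obtain ⟨φ, hφ⟩ := hne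
    exact ⟨_, φ, hφ, fun _ => Classical.arbitrary _, rfl⟩
  refine le_trans ?_ (one_sub_le_of_empirical_minimiser D hH ht hε.le _ fun T => hlearn _ T ht)
  refine sub_le_sub_left (le_trans ?_ (exp_sampleSize_le (q := ℓ + Φ.ncard) (by omega) hn hε hδ hδ1)) 1
  refine mul_le_mul_of_nonneg_right ?_ (Real.exp_pos _).le
  have : ((conceptClass Φ A x y).ncard : ℝ) ≤ ((A.size ^ (ℓ + Φ.ncard) + 1 : ℕ) : ℝ) := by
    exact_mod_cast ncard_conceptClass_le hfin A x y
  push_cast at this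
  linarith

end

/-! ## Correctness and running time of the learning program -/

theorem errorCount_ofFn {A : PreStruct σ W} {k ℓ t : ℕ} (x : Fin k → ℕ) (y : Fin ℓ → ℕ)
    (g : Formula σ W P × (Fin ℓ → A.Carrier)) (T : Fin t → Example A k) :
    errorCount x y g (List.ofFn T) =
      ({i | classifier A x y g.1 g.2 (T i).1 ≠ (T i).2} : Set (Fin t)).ncard := by
  classical
  rw [errorCount, List.ofFn_eq_map, List.countP_map, Set.ncard_eq_toFinset_card',
    Set.toFinset_ofPred, Finset.card_def, Finset.filter_val, Fin.univ_def, Multiset.filter_coe,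
    Multiset.coe_card, List.countP_eq_length_filter]
  congr 2
  ext i
  rw [Function.comp_apply]
  generalize classifier A x y g.1 g.2 (T i).1 = b
  generalize (T i).2 = c
  revert b c
  decide

/-- Applied to model checking programs, this makes the time bound `f` at least 1, so additive costs
can be charged to it. -/
theorem Eval.one_le {A : PreStruct σ W} {nb : NbrOracle A} {c : Code σ W P}
    {v u : Val σ W P A.Carrier} {τ : ℕ} (h : Eval A nb c v u τ) : 1 ≤ τ := by
  cases h <;> first | omega | (rw [PreStruct.word]; omega)

/-- The learning program finds a hypothesis with minimal training error. -/
theorem exists_learned_hypothesis {k ℓ : ℕ} (hkℓ : 0 < k ∨ ℓ = 0)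
    {x : Fin k → ℕ} {y : Fin ℓ → ℕ} (hxy : Function.Injective (Sum.elim x y))
    {r : ℕ} {Φ : Set (Formula σ W P)} (hfin : Φ.Finite) (hne : Φ.Nonempty)
    (hfree : ∀ φ ∈ Φ, (φ.free : Set ℕ) ⊆ Set.range x ∪ Set.range y)
    (hlocal : ∀ φ ∈ Φ, φ.IsLocal r) (hFV : ClosedUnderFV Φ) (hbool : ClosedUnderBool Φ)
    {M : Formula σ W P → Code σ W P} {A : WStruct σ W} {nb : NbrOracle A.toPreStruct} {f : ℝ}
    (hM : ModelChecksWithin M Φ A.toPreStruct nb x y f) {t : ℕ} (ht : 0 < t)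
    (T : Fin t → Example A.toPreStruct k) :
    ∃ g : Formula σ W P × (Fin ℓ → A.Carrier), g.1 ∈ Φ ∧
      (∀ h ∈ conceptClass Φ A.toPreStruct x y,
        trainError T (classifier A.toPreStruct x y g.1 g.2) ≤ trainError T h) ∧
      (∀ j, g.2 j ∈ A.ball ((2 * r + 1) * ℓ) {a | ∃ i c, (T i).1 c = a}) ∧
      ∃ τ, Eval A.toPreStruct nb (.learner k ℓ ((2 * r + 1) * ℓ) M hfin.toFinset.toList)
        (encodeTraining T) (encodeHypothesis g) τ ∧
        τ ≤ learnerCost k ℓ ((2 * r + 1) * ℓ) Φ.ncard A.word A.degree t ⌊f⌋₊ := by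
  set X : Set A.Carrier := {a | ∃ i c, (T i).1 c = a} with hX
  have hXne : X.Nonempty ∨ ℓ = 0 :=
    hkℓ.imp_left fun hk => ⟨_, ⟨0, ht⟩, ⟨0, hk⟩, rfl⟩
  have hmem : ∀ φ, φ ∈ hfin.toFinset.toList ↔ φ ∈ Φ := by simp
  have hrun := Runs.learner (x := x) (y := y) (nb := nb) (M := M) (F := ⌊f⌋₊) (le_refl A.degree)
    (List.ofFn T) (φs := hfin.toFinset.toList)
    (by
      obtain ⟨φ, hφ⟩ := hne
      exact List.ne_nil_of_mem ((hmem φ).2 hφ)) ((2 * r + 1) * ℓ)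
    (fun φ hφ a v => by
      obtain ⟨m, he, hm⟩ := hM φ ((hmem φ).1 hφ) a v
      exact ⟨m, Nat.le_floor hm, he⟩) (X := X) (by
      ext a
      simp [hX]) hXne
  rw [← encodeTraining_eq, List.length_ofFn, Finset.length_toList,
    ← Set.ncard_eq_toFinset_card Φ hfin] at hrun
  obtain ⟨_, τ, he, hτ, g, rfl, hg1, hg2, hmin⟩ := hrun
  refine ⟨g, (hmem _).1 hg1, ?_, hg2, τ, he, hτ⟩
  rintro _ ⟨φ, hφ, v, rfl⟩
  -- The program minimises over near parameters only; a competitor with arbitrary parameters has the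
  -- same training error as a near one.
  obtain ⟨φ', hφ', v', hv', hiff⟩ :=
    exists_near_hypothesis hxy hfree hlocal hFV hbool A hXne hφ v
  have hle := hmin (φ', v') ((hmem _).2 hφ') hv'
  rw [errorCount_ofFn, errorCount_ofFn] at hle
  have hsame : ∀ i, classifier A.toPreStruct x y φ v (T i).1 =
      classifier A.toPreStruct x y φ' v' (T i).1 := by
    intro i
    have := hiff (T i).1 fun c => ⟨i, c, rfl⟩
    exact decide_eq_decide.2 this
  unfold trainError
  simp only [hsame]
  gcongr

/-- The word length uses binary logarithms and the theorem natural ones; `log 2 > 1 / 2` gives the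
factor 2. -/
theorem cast_natLog_le {n : ℕ} (hn : 0 < n) : (Nat.log 2 n : ℝ) ≤ 2 * Real.log n := by
  have h1 : ((2 ^ Nat.log 2 n : ℕ) : ℝ) ≤ n := by exact_mod_cast Nat.pow_log_le_self 2 hn.ne'
  have h2 := Real.log_le_log (by positivity) h1
  push_cast at h2
  rw [Real.log_pow] at h2
  have h3 := Real.log_two_gt_d9
  have h4 : (0 : ℝ) ≤ Nat.log 2 n := Nat.cast_nonneg _
  nlinarith

/-- The relevant parameters are polynomially bounded. -/
theorem parameters_le {s n d : ℕ} (hn : 0 < n) {ε δ : ℝ} (hε : 0 < ε) (hε1 : ε < 1) (hδ : 0 < δ)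
    (hδ1 : δ < 1) :
    1 ≤ Real.log n + d + 1 / ε + Real.log (1 / δ) ∧
    ((Nat.log 2 n + 1 + d + sampleSize s n ε δ : ℕ) : ℝ) ≤
      (4 + 2 * s) * (Real.log n + d + 1 / ε + Real.log (1 / δ)) ^ 3 := by
  set B := Real.log n + d + 1 / ε + Real.log (1 / δ) with hB
  have hn1 : (1 : ℝ) ≤ n := by exact_mod_cast hn
  have h1 : 0 ≤ Real.log n := Real.log_nonneg hn1
  have h2 : 0 ≤ Real.log (1 / δ) := Real.log_nonneg (by rw [le_div_iff₀ hδ]; linarith)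
  have h3 : 1 ≤ 1 / ε := by rw [le_div_iff₀ hε]; linarith
  have h4 : (0 : ℝ) ≤ d := Nat.cast_nonneg _
  have hB1 : 1 ≤ B := by linarith
  refine ⟨hB1, ?_⟩
  have hlog : Real.log (n / δ) = Real.log n + Real.log (1 / δ) := by
    rw [← Real.log_mul (by positivity) (by positivity), mul_one_div]
  have hsq : 1 / ε ^ 2 ≤ B ^ 2 := by
    rw [← one_div_pow]
    gcongr
    linarith
  -- `log (n / δ) ≤ B` and `1 / ε ^ 2 ≤ B ^ 2`; rounding up adds less than `1 ≤ B ^ 3`.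
  have hceil : (⌈Real.log (n / δ) / ε ^ 2⌉₊ : ℝ) ≤ 2 * B ^ 3 := by
    have h5 : Real.log (n / δ) / ε ^ 2 ≤ B ^ 3 := by
      rw [div_eq_mul_one_div, pow_succ' B 2]
      exact mul_le_mul (by linarith) hsq (by positivity) (by linarith)
    have h6 := Nat.ceil_lt_add_one (a := Real.log (n / δ) / ε ^ 2)
      (div_nonneg (by linarith) (by positivity))
    have h7 : 1 ≤ B ^ 3 := one_le_pow₀ hB1
    linarith
  have hsamp : (sampleSize s n ε δ : ℝ) ≤ s * (2 * B ^ 3) := by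
    rw [sampleSize]
    push_cast
    gcongr
  have hw := cast_natLog_le hn
  have hB3 : B ≤ B ^ 3 := le_self_pow₀ hB1 (by norm_num)
  push_cast
  have : (4 + 2 * (s : ℝ)) * B ^ 3 = 4 * B ^ 3 + s * (2 * B ^ 3) := by ring
  linarith

end WeightAgg

end

-- The theorem: constants, program and guarantees.

theorem mainTheorem8 {S : WeightDomains} {σ : Signature} {W : WeightSymbols S}
    {P : PredicateCollection S} {k ℓ : ℕ} (hkℓ : 0 < k ∨ ℓ = 0)
    (x : Fin k → ℕ) (y : Fin ℓ → ℕ) (hxy : Function.Injective (Sum.elim x y))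
    (r : ℕ) (Φ : Set (Formula σ W P)) (hfin : Φ.Finite) (hne : Φ.Nonempty)
    (hfree : ∀ φ ∈ Φ, (φ.free : Set ℕ) ⊆ Set.range x ∪ Set.range y)
    (hlocal : ∀ φ ∈ Φ, φ.IsLocal r)
    (hFV : ClosedUnderFV Φ) (hbool : ClosedUnderBool Φ) :
    ∃ s C : ℕ, ∀ (M : Formula σ W P → Code σ W P) (f : WStruct σ W → ℝ),
      ∃ L : Code σ W P, ∀ (A : WStruct σ W) (nb : NbrOracle A.toPreStruct),
        ModelChecksWithin M Φ A.toPreStruct nb x y (f A) →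
        ∃ learn : ∀ t : ℕ, (Fin t → Example A.toPreStruct k) →
            Formula σ W P × (Fin ℓ → A.Carrier),
          IsAgnosticPACLearner (conceptClass Φ A.toPreStruct x y) (sampleSize s A.size)
            (fun t T => classifier A.toPreStruct x y (learn t T).1 (learn t T).2) ∧
          ∀ ε ∈ Set.Ioo (0 : ℝ) 1, ∀ δ ∈ Set.Ioo (0 : ℝ) 1,
            ∀ T : Fin (sampleSize s A.size ε δ) → Example A.toPreStruct k,
              (learn _ T).1 ∈ Φ ∧
              (∀ h ∈ conceptClass Φ A.toPreStruct x y,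
                trainError T (classifier A.toPreStruct x y (learn _ T).1 (learn _ T).2) ≤
                  trainError T h) ∧
              (∀ j, (learn _ T).2 j ∈ A.ball ((2 * r + 1) * ℓ) {a | ∃ i c, (T i).1 c = a}) ∧
              ∃ τ : ℕ, Eval A.toPreStruct nb L (encodeTraining T)
                  (encodeHypothesis (learn _ T)) τ ∧
                (τ : ℝ) ≤ C * f A *
                  (Real.log A.size + A.degree + 1 / ε + Real.log (1 / δ)) ^ C := by
  classical
  obtain ⟨q, ⟨K, m, hK⟩, hq⟩ := learnerCost_polyBounded k ℓ ((2 * r + 1) * ℓ) Φ.ncard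
  set s : ℕ := 2 * (ℓ + Φ.ncard) with hs
  have hs0 : 0 < s := by
    have := (Set.ncard_pos hfin).2 hne
    omega
  -- The cost is at most `f * K * X ^ m` with `X ≤ (4 + 2 * s) * B ^ 3`. This gives the coefficient
  -- and the exponent `3 * m`; since `B ≥ 1`, their maximum serves as both.
  refine ⟨s, max (K * (4 + 2 * s) ^ m) (3 * m), fun M f =>
    ⟨.learner k ℓ ((2 * r + 1) * ℓ) M hfin.toFinset.toList, fun A nb hM => ?_⟩⟩
  have hex : ∀ (t : ℕ) (T : Fin t → Example A.toPreStruct k),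
      ∃ g : Formula σ W P × (Fin ℓ → A.Carrier), 0 < t → _ := fun t T => by
    by_cases ht : 0 < t
    · obtain ⟨g, hg⟩ := exists_learned_hypothesis hkℓ hxy hfin hne hfree hlocal hFV hbool hM ht T
      exact ⟨g, fun _ => hg⟩
    -- An arbitrary value for empty training sequences, which the sample size excludes.
    · exact ⟨(hne.some, fun _ => Classical.arbitrary _), fun h => absurd h ht⟩
  choose learn hlearn using hex
  refine ⟨learn, ?_, ?_⟩
  · refine isAgnosticPACLearner_of_empirical_minimiser hfin hne _ fun t T ht => ?_
    have h := hlearn t T ht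
    exact ⟨⟨_, h.1, _, rfl⟩, h.2.1⟩
  · rintro ε ⟨hε, hε1⟩ δ ⟨hδ, hδ1⟩ T
    have hn : 0 < A.size := Fintype.card_pos
    have ht := sampleSize_pos hs0 hn hε hδ hδ1
    obtain ⟨h1, h2, h3, τ, he, hτ⟩ := hlearn _ T ht
    refine ⟨h1, h2, h3, τ, he, ?_⟩
    -- `Φ` and the universe are non-empty, so some model checking run exists, and it takes at least
    -- one step.
    have hf1 : 1 ≤ f A := by
      obtain ⟨φ, hφ⟩ := hne
      obtain ⟨m, he, hm⟩ := hM φ hφ (fun _ => Classical.arbitrary _) fun _ => Classical.arbitrary _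
      exact le_trans (by exact_mod_cast he.one_le) hm
    obtain ⟨hB, hX⟩ := parameters_le (s := s) (d := A.degree) hn hε hε1 hδ hδ1
    set B := Real.log A.size + A.degree + 1 / ε + Real.log (1 / δ)
    set X : ℕ := Nat.log 2 A.size + 1 + A.degree + sampleSize s A.size ε δ with hXdef
    have hcost : τ ≤ ⌊f A⌋₊ * (K * X ^ m) := by
      refine hτ.trans ((hq X A.word A.degree _ _ ?_ ?_ ?_ (Nat.le_floor (by simpa using hf1))).trans
        (Nat.mul_le_mul_left _ (hK X ?_)))
      · rw [PreStruct.word]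
        omega
      all_goals omega
    calc (τ : ℝ) ≤ ((⌊f A⌋₊ * (K * X ^ m) : ℕ) : ℝ) := by exact_mod_cast hcost
      _ = ⌊f A⌋₊ * (K * (X : ℝ) ^ m) := by push_cast; ring
      _ ≤ f A * (K * ((4 + 2 * s) * B ^ 3) ^ m) := by
          gcongr
          exact Nat.floor_le (by linarith)
      _ = ((K * (4 + 2 * s) ^ m : ℕ) : ℝ) * f A * B ^ (3 * m) := by
          push_cast
          rw [mul_pow, ← pow_mul]
          ring
      _ ≤ _ := by
          gcongr
          · exact le_max_left _ _
          · exact le_max_right _ _
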